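/- Conventions. A hypergraph $G$ has a finite vertex set $V(G)$ with $n$ elements and a set of edges, which are nonempty subsets of $V(G)$. It is $k$-uniform if every edge has exactly $k$ vertices, and $d$-regular if every vertex lies in exactly $d$ edges. For $k\ge 2$, a Berge $k$-cycle in $G$ consists of distinct vertices $v_1,\dots,v_k$ and distinct edges $e_1,\dots,e_k$ of $G$ with $\{v_k,v_1\}\subseteq e_1$, $\{v_1,v_2\}\subseteq e_2$, …, $\{v_{k-1},v_k\}\subseteq e_k$. The girth of a hypergraph that contains a Berge cycle is the smallest $k$ such that it contains a Berge $k$-cycle. An independent set is a set of vertices that contains no edge, and $\alpha(G)$ is the maximum size of an independent set. The randomized greedy algorithm repeatedly selects a vertex uniformly at random among the remaining vertices (at the start all vertices remain), adds it to the set of selected vertices, and removes it together with every remaining vertex $w$ that forms an edge with selected vertices (i.e. there is an edge $e\ni w$ with $e\setminus\{w\}$ contained in the set of selected vertices), until no vertices remain. Its output, the set of selected vertices, is denoted $\mathcal I$. **Theorem.** Let $r\ge 1$ and $d\ge 2$ be integers. There is exactly one positive real number $u=u(d,r)$ such that $$\sum_{m\ge 0}\binom{m+d-2}{d-2}\frac{u^{rm+1}}{rm+1}=1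 .$$ Put $$f(d,r)=u-\frac{u^{r+1}}{r+1},\qquad \epsilon(g,d,r)=\frac{d\,(d-1)^{\lfloor (g-3)/2\rfloor}}{r\prod_{k=1}^{\lfloor (g-1)/2\rfloor}\left(k+\frac1r\right)} .$$ Then $\epsilon(g,d,r)\to 0$ as $g\to\infty$, for fixed $d$ and $r$. Moreover, for every integer $g\ge 4$ and every $(r+1)$-uniform $d$-regular hypergraph $G$ on $n$ vertices with girth $g$, $$\bigl(f(d,r)-\epsilon(g,d,r)\bigr)\,n\;\le\;\mathbb E\bigl[|\mathcal I|\bigr]\;\le\;\bigl(f(d,r)+\epsilon(g,d,r)\bigr)\,n ,$$ and in particular $\alpha(G)\ge\bigl(f(d,r)-\epsilon(g,d,r)\bigr)\,n$. -/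

import Mathlib

open Filter Topology

namespace Hypergraph

/-- All edges have exactly `k` vertices. -/
def IsUniform {α : Type*} (G : Hypergraph α) (k : ℕ) : Prop :=
  ∀ e ∈ G.edgeSet, e.ncard = k

/-- The set of edges that contain the vertex `v`. -/
def incidentEdges {α : Type*} (G : Hypergraph α) (v : α) : Set (Set α) :=
  {e | e ∈ G.edgeSet ∧ v ∈ e}

/-- Every vertex lies in exactly `d` edges. (The finiteness clause only matters for `d = 0`, where
`Set.ncard` would also accept infinitely many edges.) -/
def IsRegular {α : Type*} (G : Hypergraph α) (d : ℕ) : Prop :=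
  ∀ v ∈ G.vertexSet, (G.incidentEdges v).Finite ∧ (G.incidentEdges v).ncard = d

/-- `G` contains a Berge `k`-cycle: `k ≥ 2`, distinct vertices `v 0, …, v (k - 1)` and distinct edges
`e 0, …, e (k - 1)` such that `v i` and `v (i + 1)` both lie in `e i`, indices being cyclic
(`v k = v 0`). For `k = 2` this says that two distinct edges share two distinct vertices. -/
def HasBergeCycle {α : Type*} (G : Hypergraph α) (k : ℕ) : Prop :=
  2 ≤ k ∧ ∃ (v : ℕ → α) (e : ℕ → Set α),
    Set.InjOn v (Set.Iio k) ∧ Set.InjOn e (Set.Iio k) ∧ v k = v 0 ∧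
      ∀ i < k, e i ∈ G.edgeSet ∧ v i ∈ e i ∧ v (i + 1) ∈ e i

/-- `G` contains a Berge cycle, and the shortest one has length `g`. -/
def HasGirth {α : Type*} (G : Hypergraph α) (g : ℕ) : Prop :=
  IsLeast {k | G.HasBergeCycle k} g

/-- A set of vertices that contains no edge. -/
def IsIndependent {α : Type*} (G : Hypergraph α) (S : Set α) : Prop :=
  S ⊆ G.vertexSet ∧ ∀ e ∈ G.edgeSet, ¬ e ⊆ S

/-- The independence number (the maximum size of an independent set), for a hypergraph with finitely
many vertices. -/
noncomputable def indepNumber {α : Type*} (G : Hypergraph α) : ℕ :=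
  sSup {k | ∃ S : Set α, G.IsIndependent S ∧ S.ncard = k}

/-- The vertex `w` forms an edge with the set `S`. -/
def FormsEdgeWith {α : Type*} (G : Hypergraph α) (S : Finset α) (w : α) : Prop :=
  ∃ e ∈ G.edgeSet, w ∈ e ∧ ∀ x ∈ e, x = w ∨ x ∈ S

open Classical in
/-- The distribution of the final set of the randomized greedy algorithm when it is continued from
the state in which the vertices of `I` have been selected and those of `R` remain: select `v ∈ R`
uniformly at random, delete from `R` the vertex `v` and all vertices that form an edge with the
selected ones, and repeat until no vertices remain. -/
noncomputable def greedyFrom {α : Type*} (G : Hypergraph α) (I R : Finset α) : PMF (Finset α) :=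
  if h : R.Nonempty then
    (PMF.uniformOfFinset R h).bindOnSupport fun v _ =>
      G.greedyFrom (insert v I)
        ((R.erase v).filter fun w => ¬ G.FormsEdgeWith (insert v I) w)
  else PMF.pure I
termination_by R.card
decreasing_by
  rename_i hv
  exact lt_of_le_of_lt (Finset.card_filter_le _ _)
    (Finset.card_erase_lt_of_mem ((PMF.mem_support_uniformOfFinset_iff _ _).1 hv))

/-- The distribution of the independent set that the randomized greedy algorithm produces on a
hypergraph with finitely many vertices: at the start nothing is selected and all vertices remain. -/
noncomputable def greedy {α : Type*} (G : Hypergraph α) (hG : G.vertexSet.Finite) :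
    PMF (Finset α) :=
  G.greedyFrom ∅ hG.toFinset

/-- The expected size of the set produced by the randomized greedy algorithm. (The sum has only
finitely many non-zero terms, since the set consists of vertices of `G`.) -/
noncomputable def greedyExpectedSize {α : Type*} (G : Hypergraph α) (hG : G.vertexSet.Finite) : ℝ :=
  ∑' I : Finset α, (G.greedy hG I).toReal * (I.card : ℝ)

end Hypergraph

/-- `u` is a positive real number with `∑_{n ≥ 0} C(n+d-2, d-2) u^(rn+1) / (rn+1) = 1`
(the series being convergent). -/
def IsGreedyRoot (d r : ℕ) (u : ℝ) : Prop :=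
  0 < u ∧
    HasSum (fun n : ℕ => ((n + d - 2).choose (d - 2) : ℝ) * (u ^ (r * n + 1) / ((r : ℝ) * n + 1))) 1

/-- The main term `f = u - u^(r+1) / (r+1)`. -/
noncomputable def greedyDensity (r : ℕ) (u : ℝ) : ℝ :=
  u - u ^ (r + 1) / ((r : ℝ) + 1)

/-- The error term `ε(g, d, r) = d (d-1)^⌊(g-3)/2⌋ / (r ∏_{k=1}^{⌊(g-1)/2⌋} (k + 1/r))`, for `g ≥ 3`. -/
noncomputable def greedyError (g d r : ℕ) : ℝ :=
  ((d : ℝ) * ((d : ℝ) - 1) ^ ((g - 3) / 2)) /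
    ((r : ℝ) * ∏ k ∈ Finset.Icc 1 ((g - 1) / 2), ((k : ℝ) + 1 / (r : ℝ)))

/-!
# The randomized greedy algorithm on regular uniform hypergraphs of large girth

Give the vertices independent labels, uniform on `[0, 1]`. The greedy algorithm has the same law as
inspecting all vertices in the order of their labels and selecting a vertex unless it forms an edge
with vertices selected before: vertices that the algorithm has removed are merely skipped
(`hasSum_greedyFrom`, `integral_labelledRun`). So the selected set `J` is determined by a recursion:
`w ∈ J` iff every edge at `w` contains another vertex that has a larger label or is not in `J`.

Truncate this recursion at distance `h = ⌊(g - 1) / 2⌋` and insert the constant `0` or `1` there.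
Since the rule is antitone, the two truncations bracket the indicator of `w ∈ J`
(`treeIndicator_le_ite_mem_le`). Since `2 h < g`, the part of the hypergraph seen by the recursion is
a hypertree, so that the labels in different branches are independent and the expectations of the
truncations satisfy a recursion on functions of the label of `w`, namely
`p ↦ (1 - (∫ s in 0..t, p s) ^ r) ^ (d - 1)` with exponent `d` at the root
(`integral_treeIndicator_root`). Hence the expected size of `J`, divided by `n`, lies between two
explicit numbers (`greedyExpectedSize_mem_Icc`).

The density `f(d, r)` lies between the same two numbers (`greedyDensity_mem_Icc`). The exact
solution `P` of `P' = (1 - P ^ r) ^ (d - 1)`, `P 0 = 0`, is a fixed point of the recursion;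
its inverse function is `∫ z in 0..y, (1 - z ^ r) ^ (1 - d)`, the series in the definition of
`u` is the expansion of this integral, and `P 1 = u`. The comparison is carried out in the variable
`y = P t`, so that the inverse function suffices. Finally, an induction over the levels shows that the
two numbers differ by at most `ε(g, d, r)` (`integral_rootProb_sub_le`).
-/

namespace RandomGreedy
open MeasureTheory

/-! ### The defining series and its root -/

/-- The time at which the solution of `P' = (1 - P ^ r) ^ (d - 1)`, `P 0 = 0`, reaches the value
`y`; that is, the inverse function of `P`. Meaningful for `0 ≤ y < 1`. -/
noncomputable def hittingTime (d r : ℕ) (y : ℝ) : ℝ :=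
  ∫ z in (0 : ℝ)..y, 1 / (1 - z ^ r) ^ (d - 1)

lemma one_sub_pow_pos {r : ℕ} (hr : 1 ≤ r) {z : ℝ} (hz : |z| < 1) : 0 < 1 - z ^ r := by
  have h1 : |z ^ r| < 1 := by
    rw [abs_pow]; exact pow_lt_one₀ (abs_nonneg _) hz (by omega)
  linarith [le_abs_self (z ^ r)]

lemma continuousOn_hittingTime_integrand {d r : ℕ} (hr : 1 ≤ r) :
    ContinuousOn (fun z : ℝ => 1 / (1 - z ^ r) ^ (d - 1)) (Set.Ioo (-1) 1) := by
  apply ContinuousOn.div continuousOn_const (by fun_prop)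
  intro z hz
  exact (pow_pos (one_sub_pow_pos hr (abs_lt.2 hz)) _).ne'

lemma uIcc_zero_subset_Ioo {y : ℝ} (hy : |y| < 1) : Set.uIcc 0 y ⊆ Set.Ioo (-1) 1 := by
  rw [abs_lt] at hy
  intro z hz
  rcases Set.mem_uIcc.1 hz with h | h <;> constructor <;> linarith [h.1, h.2]

lemma hasDerivAt_hittingTime {d r : ℕ} (hr : 1 ≤ r) {y : ℝ} (hy : |y| < 1) :
    HasDerivAt (hittingTime d r) (1 / (1 - y ^ r) ^ (d - 1)) y := by
  have hc := continuousOn_hittingTime_integrand (d := d) hr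
  have hmem : y ∈ Set.Ioo (-1 : ℝ) 1 := abs_lt.1 hy
  have hca := hc.continuousAt (isOpen_Ioo.mem_nhds hmem)
  refine intervalIntegral.integral_hasDerivAt_right ?_ ?_ hca
  · exact (hc.mono (uIcc_zero_subset_Ioo hy)).intervalIntegrable
  · exact hc.stronglyMeasurableAtFilter isOpen_Ioo y hmem

@[simp] lemma hittingTime_zero (d r : ℕ) : hittingTime d r 0 = 0 := by simp [hittingTime]

lemma continuousOn_hittingTime {d r : ℕ} (hr : 1 ≤ r) {u : ℝ} (hu : u < 1) :
    ContinuousOn (hittingTime d r) (Set.Icc 0 u) := fun y hy =>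
  (hasDerivAt_hittingTime hr
    (abs_lt.2 ⟨by linarith [hy.1], by linarith [hy.2]⟩)).continuousAt.continuousWithinAt

lemma strictMonoOn_hittingTime {d r : ℕ} (hr : 1 ≤ r) {u : ℝ} (hu : u < 1) :
    StrictMonoOn (hittingTime d r) (Set.Icc 0 u) := by
  refine strictMonoOn_of_deriv_pos (convex_Icc _ _) (continuousOn_hittingTime hr hu) ?_
  intro y hy
  rw [interior_Icc] at hy
  have hy' : |y| < 1 := abs_lt.2 ⟨by linarith [hy.1], by linarith [hy.2]⟩
  rw [(hasDerivAt_hittingTime hr hy').deriv]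
  exact one_div_pos.2 (pow_pos (one_sub_pow_pos hr hy') _)

/-- The series that defines the root is the termwise integral of the binomial series of
`(1 - z ^ r) ^ (1 - d)`. -/
lemma hasSum_hittingTime {d r : ℕ} (hr : 1 ≤ r) (hd : 2 ≤ d) {y : ℝ} (hy0 : 0 ≤ y) (hy : y < 1) :
    HasSum (fun n : ℕ => ((n + d - 2).choose (d - 2) : ℝ) * (y ^ (r * n + 1) / ((r : ℝ) * n + 1)))
      (hittingTime d r y) := by
  have key : ∀ z : ℝ, 0 ≤ z → z < 1 →
      HasSum (fun n : ℕ => ((n + d - 2).choose (d - 2) : ℝ) * z ^ (r * n))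
        (1 / (1 - z ^ r) ^ (d - 1)) := by
    intro z hz0 hz
    have hzr : ‖z ^ r‖ < 1 := by
      rw [Real.norm_of_nonneg (by positivity)]; exact pow_lt_one₀ hz0 hz (by omega)
    have h := hasSum_choose_mul_geometric_of_norm_lt_one (d - 2) hzr
    rw [show d - 2 + 1 = d - 1 by omega] at h
    refine h.congr_fun ?_
    intro n
    rw [pow_mul, show n + d - 2 = n + (d - 2) by omega]
  have h := intervalIntegral.hasSum_integral_of_dominated_convergence (μ := volume) (a := 0) (b := y)
    (F := fun (n : ℕ) (z : ℝ) => ((n + d - 2).choose (d - 2) : ℝ) * z ^ (r * n))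
    (f := fun z : ℝ => 1 / (1 - z ^ r) ^ (d - 1))
    (fun n _ => ((n + d - 2).choose (d - 2) : ℝ) * y ^ (r * n))
    (fun n => by fun_prop) ?_ ?_ ?_ ?_
  · refine h.congr_fun ?_
    intro n
    rw [intervalIntegral.integral_const_mul, integral_pow]
    push_cast
    simp
  · intro n
    refine Eventually.of_forall fun z hz => ?_
    rw [Set.uIoc_of_le hy0] at hz
    rw [Real.norm_of_nonneg (by have := hz.1.le; positivity)]
    have := hz.1.le
    have := hz.2
    gcongr
  · exact Eventually.of_forall fun z hz => (key y hy0 hy).summable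
  · simp
  · refine Eventually.of_forall fun z hz => ?_
    rw [Set.uIoc_of_le hy0] at hz
    exact key z hz.1.le (hz.2.trans_lt hy)

/-- A root is less than `1`, since the first term of the series, `u`, is less than its sum. -/
lemma isGreedyRoot_iff {d r : ℕ} (hr : 1 ≤ r) (hd : 2 ≤ d) {u : ℝ} :
    IsGreedyRoot d r u ↔ 0 < u ∧ u < 1 ∧ hittingTime d r u = 1 := by
  constructor
  · rintro ⟨h0, hs⟩
    have hlt : u < 1 := by
      have hnn : ∀ n : ℕ, 0 ≤ ((n + d - 2).choose (d - 2) : ℝ) *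
          (u ^ (r * n + 1) / ((r : ℝ) * n + 1)) := fun n => by positivity
      have h := sum_le_hasSum (Finset.range 2) (fun n _ => hnn n) hs
      rw [Finset.sum_range_succ, Finset.sum_range_one] at h
      have h1 : 0 < ((1 + d - 2).choose (d - 2) : ℝ) * (u ^ (r * 1 + 1) / ((r : ℝ) * (1 : ℕ) + 1)) := by
        have : 0 < (1 + d - 2).choose (d - 2) := Nat.choose_pos (by omega)
        positivity
      simp at h h1
      linarith
    exact ⟨h0, hlt, (hasSum_hittingTime hr hd h0.le hlt).unique hs⟩
  · rintro ⟨h0, h1, h⟩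
    exact ⟨h0, h ▸ hasSum_hittingTime hr hd h0.le h1⟩

/-- The hitting time is unbounded near `1`, because the series diverges there like the harmonic
series. -/
lemma exists_one_lt_hittingTime {d r : ℕ} (hr : 1 ≤ r) (hd : 2 ≤ d) :
    ∃ y : ℝ, 0 < y ∧ y < 1 ∧ 1 < hittingTime d r y := by
  obtain ⟨N, hN⟩ : ∃ N : ℕ, 1 < ∑ n ∈ Finset.range N, (1 : ℝ) ^ (r * n + 1) / ((r : ℝ) * n + 1) := by
    have h := (Real.tendsto_sum_range_one_div_nat_succ_atTop).eventually_gt_atTop (r : ℝ)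
    obtain ⟨N, hN⟩ := h.exists
    refine ⟨N, ?_⟩
    have hr0 : (0 : ℝ) < r := by exact_mod_cast hr
    have : (∑ n ∈ Finset.range N, 1 / ((n : ℝ) + 1)) / r
        ≤ ∑ n ∈ Finset.range N, (1 : ℝ) ^ (r * n + 1) / ((r : ℝ) * n + 1) := by
      rw [Finset.sum_div]
      refine Finset.sum_le_sum fun n _ => ?_
      rw [one_pow, div_div]
      have : (1 : ℝ) ≤ r := by exact_mod_cast hr
      apply one_div_le_one_div_of_le (by positivity)
      nlinarith
    refine lt_of_lt_of_le ?_ this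
    rwa [one_lt_div hr0]
  have hcont : Continuous fun y : ℝ =>
      ∑ n ∈ Finset.range N, y ^ (r * n + 1) / ((r : ℝ) * n + 1) := by fun_prop
  have h1 : ∀ᶠ y in 𝓝[<] (1 : ℝ), 1 < ∑ n ∈ Finset.range N, y ^ (r * n + 1) / ((r : ℝ) * n + 1) :=
    (hcont.tendsto 1).eventually_const_lt hN |>.filter_mono nhdsWithin_le_nhds
  have h2 : ∀ᶠ y in 𝓝[<] (1 : ℝ), y ∈ Set.Ioo (0 : ℝ) 1 := Ioo_mem_nhdsLT one_pos
  obtain ⟨y, hy1, hy2⟩ := (h1.and h2).exists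
  refine ⟨y, hy2.1, hy2.2, hy1.trans_le ?_⟩
  have hy0 := hy2.1.le
  refine le_trans ?_ (sum_le_hasSum (Finset.range N) (fun n _ => by positivity)
    (hasSum_hittingTime hr hd hy0 hy2.2))
  refine Finset.sum_le_sum fun n _ => ?_
  have : 0 < (n + d - 2).choose (d - 2) := Nat.choose_pos (by omega)
  have : (1 : ℝ) ≤ (n + d - 2).choose (d - 2) := by exact_mod_cast this
  exact le_mul_of_one_le_left (by positivity) this

lemma existsUnique_isGreedyRoot {d r : ℕ} (hr : 1 ≤ r) (hd : 2 ≤ d) :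
    ∃! u : ℝ, IsGreedyRoot d r u := by
  obtain ⟨y, hy0, hy1, hy⟩ := exists_one_lt_hittingTime hr hd
  obtain ⟨u, hu, hu1⟩ := intermediate_value_Icc hy0.le (continuousOn_hittingTime (d := d) hr hy1)
    (show (1 : ℝ) ∈ Set.Icc _ _ by simp [hy.le])
  have hupos : 0 < u := by
    rcases hu.1.eq_or_lt with h | h
    · rw [← h, hittingTime_zero] at hu1; norm_num at hu1
    · exact h
  refine ⟨u, (isGreedyRoot_iff hr hd).2 ⟨hupos, hu.2.trans_lt hy1, hu1⟩, ?_⟩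
  intro v hv
  obtain ⟨hv0, hv1, hv⟩ := (isGreedyRoot_iff hr hd).1 hv
  have hm := strictMonoOn_hittingTime (d := d) hr (u := max u v) (max_lt (hu.2.trans_lt hy1) hv1)
  exact hm.injOn ⟨hv0.le, le_max_right _ _⟩ ⟨hupos.le, le_max_left _ _⟩ (hv.trans hu1.symm)

/-! ### Selection probabilities in truncated hypertrees -/

/-- The probability that a non-root vertex with label `t` is selected, in a hypertree with `k` levels
of edges below it in which every non-leaf has `d - 1` child edges with `r` children each. For
`k = 0` it is `1` or `0`, depending on the flag. The flag is flipped at each level because the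
recursion is antitone; in this way `true` gives an upper and `false` a lower bound of the selection
probability, whatever happens at the leaves. -/
noncomputable def treeProb (d r : ℕ) : ℕ → Bool → ℝ → ℝ
  | 0, b, _ => if b then 1 else 0
  | k + 1, b, t => (1 - (∫ s in (0 : ℝ)..t, treeProb d r k (!b) s) ^ r) ^ (d - 1)

/-- The analogue of `treeProb` for the root, which has `d` child edges. The hypertree has `k + 1`
levels of edges. -/
noncomputable def rootProb (d r k : ℕ) (b : Bool) (t : ℝ) : ℝ :=
  (1 - (∫ s in (0 : ℝ)..t, treeProb d r k (!b) s) ^ r) ^ d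

lemma continuous_treeProb (d r k : ℕ) (b : Bool) : Continuous (treeProb d r k b) := by
  induction k generalizing b with
  | zero => exact continuous_const
  | succ k ih =>
    have := intervalIntegral.continuous_primitive
      (fun a c => (ih (!b)).intervalIntegrable (μ := volume) a c) 0
    change Continuous fun t : ℝ => (1 - (∫ s in (0 : ℝ)..t, treeProb d r k (!b) s) ^ r) ^ (d - 1)
    fun_prop

lemma continuous_integral_treeProb (d r k : ℕ) (b : Bool) :
    Continuous fun t : ℝ => ∫ s in (0 : ℝ)..t, treeProb d r k b s :=
  intervalIntegral.continuous_primitive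
    (fun a c => (continuous_treeProb d r k b).intervalIntegrable (μ := volume) a c) 0

lemma continuous_rootProb (d r k : ℕ) (b : Bool) : Continuous (rootProb d r k b) := by
  have := continuous_integral_treeProb d r k (!b)
  unfold rootProb
  fun_prop

lemma integral_mem_Icc_of_mem_Icc {p : ℝ → ℝ} (hp : Continuous p)
    (h : ∀ t ∈ Set.Icc (0 : ℝ) 1, p t ∈ Set.Icc (0 : ℝ) 1) {t : ℝ} (ht : t ∈ Set.Icc (0 : ℝ) 1) :
    ∫ s in (0 : ℝ)..t, p s ∈ Set.Icc 0 t := by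
  constructor
  · exact intervalIntegral.integral_nonneg ht.1 fun s hs => (h s ⟨hs.1, hs.2.trans ht.2⟩).1
  · have := intervalIntegral.integral_mono_on ht.1 (hp.intervalIntegrable (μ := volume) 0 t)
      (continuous_const (y := (1 : ℝ)).intervalIntegrable 0 t)
      fun s hs => (h s ⟨hs.1, hs.2.trans ht.2⟩).2
    simpa using this

lemma treeProb_mem_Icc (d r k : ℕ) (b : Bool) :
    ∀ t ∈ Set.Icc (0 : ℝ) 1, treeProb d r k b t ∈ Set.Icc (0 : ℝ) 1 := by
  induction k generalizing b with
  | zero => intro t _; cases b <;> simp [treeProb]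
  | succ k ih =>
    intro t ht
    have h := integral_mem_Icc_of_mem_Icc (continuous_treeProb d r k (!b)) (ih _) ht
    have h1 : (∫ s in (0 : ℝ)..t, treeProb d r k (!b) s) ^ r ≤ 1 :=
      pow_le_one₀ h.1 (h.2.trans ht.2)
    have h0 : 0 ≤ (∫ s in (0 : ℝ)..t, treeProb d r k (!b) s) ^ r := pow_nonneg h.1 _
    exact ⟨pow_nonneg (by linarith) _, pow_le_one₀ (by linarith) (by linarith)⟩

lemma integral_treeProb_mem_Icc (d r k : ℕ) (b : Bool) {t : ℝ} (ht : t ∈ Set.Icc (0 : ℝ) 1) :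
    ∫ s in (0 : ℝ)..t, treeProb d r k b s ∈ Set.Icc 0 t :=
  integral_mem_Icc_of_mem_Icc (continuous_treeProb d r k b) (treeProb_mem_Icc d r k b) ht

lemma abs_one_sub_pow_sub_le {a b : ℝ} (ha : a ∈ Set.Icc (0 : ℝ) 1) (hb : b ∈ Set.Icc (0 : ℝ) 1)
    (m : ℕ) : |(1 - a) ^ m - (1 - b) ^ m| ≤ m * |a - b| := by
  have h := abs_pow_sub_pow_le (1 - a) (1 - b) m
  have hm : max |1 - a| |1 - b| ^ (m - 1) ≤ 1 := by
    apply pow_le_one₀ (le_max_of_le_left (abs_nonneg _))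
    apply max_le <;> rw [abs_le] <;> constructor <;> linarith [ha.1, ha.2, hb.1, hb.2]
  rw [show (1 - a) - (1 - b) = -(a - b) by ring, abs_neg] at h
  refine h.trans ?_
  rw [mul_comm |a - b|]
  exact mul_le_of_le_one_right (by positivity) hm

/-- The coefficient in the bound for the gap between the two truncated recursions with `k` levels. -/
noncomputable def gapCoeff (d r k : ℕ) : ℝ :=
  ((r : ℝ) * ((d : ℝ) - 1)) ^ k / ∏ j ∈ Finset.Icc 1 k, ((j : ℝ) * r + 1)

lemma gapCoeff_succ (d r k : ℕ) :
    gapCoeff d r (k + 1) = r * ((d - 1) * gapCoeff d r k / (((k : ℝ) + 1) * r + 1)) := by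
  unfold gapCoeff
  rw [Finset.prod_Icc_succ_top (by omega), pow_succ]
  have h1 : (∏ j ∈ Finset.Icc 1 k, ((j : ℝ) * r + 1)) ≠ 0 :=
    Finset.prod_ne_zero_iff.2 fun j _ => by positivity
  have h2 : ((k : ℝ) + 1) * r + 1 ≠ 0 := by positivity
  push_cast
  field_simp

/-- If two integrands are within `c * s ^ m` of each other, their primitives are within
`c * t ^ (m + 1) / (m + 1)`. -/
lemma abs_integral_sub_le_of_abs_sub_le {p q : ℝ → ℝ} (hp : Continuous p) (hq : Continuous q)
    {c t : ℝ} {m : ℕ} (ht : 0 ≤ t) (h : ∀ s ∈ Set.Icc 0 t, |p s - q s| ≤ c * s ^ m) :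
    |(∫ s in (0 : ℝ)..t, p s) - ∫ s in (0 : ℝ)..t, q s| ≤ c * t ^ (m + 1) / (m + 1) := by
  rw [← intervalIntegral.integral_sub (hp.intervalIntegrable _ _) (hq.intervalIntegrable _ _)]
  refine (intervalIntegral.abs_integral_le_integral_abs ht).trans ?_
  have : ∫ s in (0 : ℝ)..t, c * s ^ m = c * t ^ (m + 1) / (m + 1) := by
    rw [intervalIntegral.integral_const_mul, integral_pow]; simp [mul_div_assoc]
  rw [← this]
  refine intervalIntegral.integral_mono_on ht ?_ ?_ h
  · exact (hp.sub hq).abs.intervalIntegrable _ _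
  · exact Continuous.intervalIntegrable (by fun_prop) _ _

/-- The gap between the two truncated recursions. It is stated for the `r`-th powers of the
primitives, because `t ^ r - 0 ^ r = t ^ r` is a better start of the induction than a bound through
the derivative of the power, which would cost an additional factor `r`. -/
lemma abs_pow_integral_treeProb_sub_le {d r : ℕ} (hr : 1 ≤ r) (hd : 2 ≤ d) (k : ℕ) (b : Bool) :
    ∀ t ∈ Set.Icc (0 : ℝ) 1,
      |(∫ s in (0 : ℝ)..t, treeProb d r k b s) ^ r - (∫ s in (0 : ℝ)..t, treeProb d r k (!b) s) ^ r|
        ≤ gapCoeff d r k * t ^ ((k + 1) * r) := by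
  induction k generalizing b with
  | zero =>
    intro t ht
    have : (0 : ℝ) ^ r = 0 := zero_pow (by omega)
    have h2 : |t ^ r| = t ^ r := abs_of_nonneg (pow_nonneg ht.1 _)
    cases b <;> simp [treeProb, gapCoeff, this, h2]
  | succ k ih =>
    intro t ht
    have hA := integral_treeProb_mem_Icc d r (k + 1) b ht
    have hB := integral_treeProb_mem_Icc d r (k + 1) (!b) ht
    have hd1 : ((d - 1 : ℕ) : ℝ) = (d : ℝ) - 1 := by rw [Nat.cast_sub (by omega)]; simp
    have hint : |(∫ s in (0 : ℝ)..t, treeProb d r (k + 1) b s) -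
        ∫ s in (0 : ℝ)..t, treeProb d r (k + 1) (!b) s|
        ≤ ((d : ℝ) - 1) * gapCoeff d r k * t ^ ((k + 1) * r + 1) / (((k + 1) * r : ℕ) + 1) := by
      refine abs_integral_sub_le_of_abs_sub_le (continuous_treeProb _ _ _ _)
        (continuous_treeProb _ _ _ _) ht.1 fun s hs => ?_
      have hs' : s ∈ Set.Icc (0 : ℝ) 1 := ⟨hs.1, hs.2.trans ht.2⟩
      have hpow : ∀ b, (∫ x in (0 : ℝ)..s, treeProb d r k b x) ^ r ∈ Set.Icc (0 : ℝ) 1 := by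
        intro b
        have := integral_treeProb_mem_Icc d r k b hs'
        exact ⟨pow_nonneg this.1 _, pow_le_one₀ this.1 (this.2.trans hs'.2)⟩
      refine (abs_one_sub_pow_sub_le (hpow _) (hpow _) (d - 1)).trans ?_
      rw [hd1, mul_assoc]
      exact mul_le_mul_of_nonneg_left (ih _ s hs')
        (sub_nonneg.2 (by exact_mod_cast (by omega : 1 ≤ d)))
    refine (abs_pow_sub_pow_le _ _ r).trans ?_
    have hmax : max |∫ s in (0 : ℝ)..t, treeProb d r (k + 1) b s|
        |∫ s in (0 : ℝ)..t, treeProb d r (k + 1) (!b) s| ≤ t := by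
      rw [abs_of_nonneg hA.1, abs_of_nonneg hB.1]
      exact max_le hA.2 hB.2
    have hmax0 : 0 ≤ max |∫ s in (0 : ℝ)..t, treeProb d r (k + 1) b s|
        |∫ s in (0 : ℝ)..t, treeProb d r (k + 1) (!b) s| := le_max_of_le_left (abs_nonneg _)
    calc _ ≤ ((d : ℝ) - 1) * gapCoeff d r k * t ^ ((k + 1) * r + 1) / (((k + 1) * r : ℕ) + 1)
          * r * t ^ (r - 1) := by
          have := (abs_nonneg _).trans hint
          gcongr
      _ = _ := by
          rw [gapCoeff_succ, show (k + 1 + 1) * r = ((k + 1) * r + 1) + (r - 1) by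
            rw [add_mul (k + 1) 1 r]; omega, pow_add t ((k + 1) * r + 1)]
          push_cast
          ring

lemma prod_mul_add_one_eq {r : ℕ} (hr : 1 ≤ r) (h : ℕ) :
    ∏ j ∈ Finset.Icc 1 h, ((j : ℝ) * r + 1)
      = (r : ℝ) ^ h * ∏ k ∈ Finset.Icc 1 h, ((k : ℝ) + 1 / (r : ℝ)) := by
  have hr0 : (r : ℝ) ≠ 0 := by positivity
  calc _ = ∏ k ∈ Finset.Icc 1 h, ((r : ℝ) * ((k : ℝ) + 1 / (r : ℝ))) :=
        Finset.prod_congr rfl fun k _ => by field_simp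
    _ = _ := by rw [Finset.prod_mul_distrib]; simp

lemma integral_rootProb_sub_le {d r g : ℕ} (hr : 1 ≤ r) (hd : 2 ≤ d) (hg : 3 ≤ g) (b : Bool) :
    |(∫ t in (0 : ℝ)..1, rootProb d r ((g - 3) / 2) b t) -
      ∫ t in (0 : ℝ)..1, rootProb d r ((g - 3) / 2) (!b) t| ≤ greedyError g d r := by
  set k := (g - 3) / 2 with hk
  have hbound : |(∫ t in (0 : ℝ)..1, rootProb d r k b t) - ∫ t in (0 : ℝ)..1, rootProb d r k (!b) t|
      ≤ d * gapCoeff d r k * 1 ^ ((k + 1) * r + 1) / (((k + 1) * r : ℕ) + 1) := by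
    refine abs_integral_sub_le_of_abs_sub_le (continuous_rootProb _ _ _ _)
        (continuous_rootProb _ _ _ _) zero_le_one fun s hs' => ?_
    have hpow : ∀ b, (∫ x in (0 : ℝ)..s, treeProb d r k b x) ^ r ∈ Set.Icc (0 : ℝ) 1 := by
      intro b
      have := integral_treeProb_mem_Icc d r k b hs'
      exact ⟨pow_nonneg this.1 _, pow_le_one₀ this.1 (this.2.trans hs'.2)⟩
    refine (abs_one_sub_pow_sub_le (hpow _) (hpow _) d).trans ?_
    rw [mul_assoc]
    exact mul_le_mul_of_nonneg_left (abs_pow_integral_treeProb_sub_le hr hd _ _ s hs')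
      (Nat.cast_nonneg _)
  refine hbound.trans_eq ?_
  have hk1 : (g - 1) / 2 = k + 1 := by omega
  have hr0 : (r : ℝ) ≠ 0 := by positivity
  have hP : ∏ k ∈ Finset.Icc 1 (k + 1), ((k : ℝ) + 1 / (r : ℝ)) ≠ 0 :=
    Finset.prod_ne_zero_iff.2 fun j _ => by positivity
  have hQ : ∏ j ∈ Finset.Icc 1 k, ((j : ℝ) * r + 1) ≠ 0 :=
    Finset.prod_ne_zero_iff.2 fun j _ => by positivity
  have hS : ((k : ℝ) + 1) * r + 1 ≠ 0 := by positivity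
  have h' := prod_mul_add_one_eq hr (k + 1)
  rw [Finset.prod_Icc_succ_top (by omega)] at h'
  unfold greedyError gapCoeff
  rw [← hk, hk1, one_pow, mul_one, mul_pow]
  push_cast at h' ⊢
  -- `∏ (j r + 1) = r ^ (k + 1) ∏ (j + 1 / r)` turns the factor `r ^ k` into `1 / r`.
  rw [mul_div_assoc, div_div, h', pow_succ]
  field_simp

lemma tendsto_greedyError {d r : ℕ} (hr : 1 ≤ r) (hd : 2 ≤ d) :
    Tendsto (fun g : ℕ => greedyError g d r) atTop (𝓝 0) := by
  have hd1 : (1 : ℝ) ≤ (d : ℝ) - 1 := by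
    have : (2 : ℝ) ≤ d := by exact_mod_cast hd
    linarith
  have hhalf : Tendsto (fun g : ℕ => (g - 1) / 2) atTop atTop := by
    refine tendsto_atTop.2 fun b => ?_
    filter_upwards [eventually_ge_atTop (2 * b + 1)] with g hg
    omega
  have hlim := ((FloorSemiring.tendsto_pow_div_factorial_atTop ((d : ℝ) - 1)).comp
    hhalf).const_mul ((d : ℝ) / r)
  rw [mul_zero] at hlim
  refine squeeze_zero (fun g => ?_) (fun g => ?_) hlim
  · have : 0 ≤ (d : ℝ) - 1 := by linarith
    unfold greedyError
    positivity
  · have hfac : (((g - 1) / 2).factorial : ℝ) ≤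
        ∏ k ∈ Finset.Icc 1 ((g - 1) / 2), ((k : ℝ) + 1 / (r : ℝ)) := by
      rw [← Finset.prod_Ico_id_eq_factorial,
        show Finset.Ico 1 ((g - 1) / 2 + 1) = Finset.Icc 1 ((g - 1) / 2) by
          ext; simp]
      push_cast
      exact Finset.prod_le_prod (fun k _ => by positivity) fun k _ => by
        have : 0 ≤ 1 / (r : ℝ) := by positivity
        linarith
    have hr0 : (0 : ℝ) < r := by positivity
    have hf0 : (0 : ℝ) < ((g - 1) / 2).factorial := by positivity
    simp only [Function.comp_apply, greedyError]
    rw [div_mul_div_comm]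
    have hpow : ((d : ℝ) - 1) ^ ((g - 3) / 2) ≤ ((d : ℝ) - 1) ^ ((g - 1) / 2) :=
      pow_le_pow_right₀ hd1 (by omega)
    gcongr

/-! ### Comparison of the truncated recursions with the limit -/

lemma le_of_hasDerivAt_le {F G F' G' : ℝ → ℝ} {u : ℝ}
    (hF : ∀ y ∈ Set.Icc 0 u, HasDerivAt F (F' y) y)
    (hG : ∀ y ∈ Set.Icc 0 u, HasDerivAt G (G' y) y) (h0 : F 0 ≤ G 0)
    (h : ∀ y ∈ Set.Icc 0 u, F' y ≤ G' y) : ∀ y ∈ Set.Icc 0 u, F y ≤ G y := by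
  have hmono : MonotoneOn (fun y => G y - F y) (Set.Icc 0 u) := by
    refine monotoneOn_of_deriv_nonneg (convex_Icc _ _)
      (fun y hy => ((hG y hy).sub (hF y hy)).continuousAt.continuousWithinAt) ?_ ?_
    · intro y hy
      have hy := interior_subset hy
      exact ((hG y hy).sub (hF y hy)).differentiableAt.differentiableWithinAt
    · intro y hy
      have hy := interior_subset hy
      have := ((hG y hy).sub (hF y hy)).deriv
      change 0 ≤ deriv (G - F) y
      rw [this]
      linarith [h y hy]
  intro y hy
  have := hmono ⟨le_rfl, hy.1.trans hy.2⟩ hy hy.1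
  simp only at this
  linarith

lemma hasDerivAt_integral_hittingTime {d r : ℕ} (hr : 1 ≤ r) {p : ℝ → ℝ} (hp : Continuous p) {y : ℝ}
    (hy : |y| < 1) : HasDerivAt (fun y => ∫ s in (0 : ℝ)..hittingTime d r y, p s)
      (p (hittingTime d r y) * (1 / (1 - y ^ r) ^ (d - 1))) y :=
  (hp.integral_hasStrictDerivAt 0 (hittingTime d r y)).hasDerivAt.comp y
    (hasDerivAt_hittingTime hr hy)

lemma hasDerivAt_greedyDensity (r : ℕ) (y : ℝ) : HasDerivAt (greedyDensity r) (1 - y ^ r) y := by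
  have h := (hasDerivAt_id y).sub ((hasDerivAt_pow (r + 1) y).div_const ((r : ℝ) + 1))
  have h2 : ((r + 1 : ℕ) : ℝ) * y ^ (r + 1 - 1) / ((r : ℝ) + 1) = y ^ r := by
    have : (r : ℝ) + 1 ≠ 0 := by positivity
    push_cast
    field_simp
  rw [h2] at h
  exact h

lemma hittingTime_mem_Icc {d r : ℕ} {u : ℝ} (hr : 1 ≤ r) (hu0 : 0 ≤ u) (hu : u < 1)
    (hu1 : hittingTime d r u = 1) {y : ℝ} (hy : y ∈ Set.Icc 0 u) :
    hittingTime d r y ∈ Set.Icc (0 : ℝ) 1 := by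
  have hm := (strictMonoOn_hittingTime (d := d) hr hu).monotoneOn
  constructor
  · simpa using hm ⟨le_rfl, hu0⟩ hy hy.1
  · simpa [hu1] using hm hy ⟨hu0, le_rfl⟩ hy.2

/-- Both truncations bracket the exact solution `y` at time `hittingTime d r y`. -/
lemma integral_treeProb_hittingTime {d r : ℕ} {u : ℝ} (hr : 1 ≤ r) (hu0 : 0 ≤ u) (hu : u < 1)
    (hu1 : hittingTime d r u = 1) (k : ℕ) : ∀ y ∈ Set.Icc 0 u,
    ∫ s in (0 : ℝ)..hittingTime d r y, treeProb d r k false s ≤ y ∧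
      y ≤ ∫ s in (0 : ℝ)..hittingTime d r y, treeProb d r k true s := by
  have habs : ∀ y ∈ Set.Icc 0 u, |y| < 1 := fun y hy =>
    abs_lt.2 ⟨by linarith [hy.1], by linarith [hy.2]⟩
  induction k with
  | zero =>
    -- The derivative of `hittingTime` is at least `1`.
    have hle : ∀ y ∈ Set.Icc 0 u, y ≤ hittingTime d r y := by
      refine le_of_hasDerivAt_le (fun y _ => hasDerivAt_id y)
        (fun y hy => hasDerivAt_hittingTime hr (habs y hy)) (by simp) fun y hy => ?_
      have := one_sub_pow_pos hr (habs y hy)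
      rw [one_le_div (by positivity)]
      exact pow_le_one₀ this.le (by linarith [pow_nonneg hy.1 r])
    intro y hy
    simpa [treeProb] using ⟨hy.1, hle y hy⟩
  | succ k ih =>
    have hT := fun y hy => hittingTime_mem_Icc (d := d) hr hu0 hu hu1 (y := y) hy
    intro y hy
    constructor
    · refine le_of_hasDerivAt_le
        (fun y hy => hasDerivAt_integral_hittingTime hr (continuous_treeProb d r (k + 1) false)
          (habs y hy)) (fun y _ => hasDerivAt_id y) (by simp) (fun y hy => ?_) y hy
      have hpos := one_sub_pow_pos hr (habs y hy)
      rw [mul_one_div, div_le_one (by positivity)]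
      have hmem := integral_treeProb_mem_Icc d r k true (hT y hy)
      have h1 : (∫ s in (0 : ℝ)..hittingTime d r y, treeProb d r k true s) ^ r ≤ 1 :=
        pow_le_one₀ hmem.1 (hmem.2.trans (hT y hy).2)
      refine pow_le_pow_left₀ (by simpa using h1) ?_ _
      exact sub_le_sub_left (pow_le_pow_left₀ hy.1 (ih y hy).2 r) 1
    · refine le_of_hasDerivAt_le (fun y _ => hasDerivAt_id y)
        (fun y hy => hasDerivAt_integral_hittingTime hr (continuous_treeProb d r (k + 1) true)
          (habs y hy)) (by simp) (fun y hy => ?_) y hy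
      have hpos := one_sub_pow_pos hr (habs y hy)
      rw [mul_one_div, one_le_div (by positivity)]
      have hmem := integral_treeProb_mem_Icc d r k false (hT y hy)
      refine pow_le_pow_left₀ hpos.le ?_ _
      exact sub_le_sub_left (pow_le_pow_left₀ hmem.1 (ih y hy).1 r) 1

/-- The limiting density lies between the selection probabilities of the roots of the two truncated
hypertrees. -/
lemma greedyDensity_mem_Icc {d r : ℕ} {u : ℝ} (hr : 1 ≤ r) (hu0 : 0 ≤ u) (hu : u < 1)
    (hu1 : hittingTime d r u = 1)
    (hd : 1 ≤ d) (k : ℕ) :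
    greedyDensity r u ∈ Set.Icc (∫ t in (0 : ℝ)..1, rootProb d r k false t)
      (∫ t in (0 : ℝ)..1, rootProb d r k true t) := by
  have habs : ∀ y ∈ Set.Icc 0 u, |y| < 1 := fun y hy =>
    abs_lt.2 ⟨by linarith [hy.1], by linarith [hy.2]⟩
  have hT := fun y hy => hittingTime_mem_Icc (d := d) hr hu0 hu hu1 (y := y) hy
  have hS := integral_treeProb_hittingTime (d := d) hr hu0 hu hu1 k
  have hzero : greedyDensity r 0 = 0 := by simp [greedyDensity]
  have hdd : ∀ x : ℝ, x ^ d = x * x ^ (d - 1) := fun x => by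
    rw [← pow_succ', Nat.sub_add_cancel hd]
  constructor
  · have := le_of_hasDerivAt_le
        (fun y hy => hasDerivAt_integral_hittingTime (d := d) hr (continuous_rootProb d r k false)
          (habs y hy)) (fun y _ => hasDerivAt_greedyDensity r y) (by simp [hzero]) (fun y hy => ?_)
          u ⟨hu0, le_rfl⟩
    · rwa [hu1] at this
    · have hpos := one_sub_pow_pos hr (habs y hy)
      rw [mul_one_div, div_le_iff₀ (by positivity), ← hdd]
      have hmem := integral_treeProb_mem_Icc d r k true (hT y hy)
      have h1 : (∫ s in (0 : ℝ)..hittingTime d r y, treeProb d r k true s) ^ r ≤ 1 :=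
        pow_le_one₀ hmem.1 (hmem.2.trans (hT y hy).2)
      refine pow_le_pow_left₀ (by simpa using h1) ?_ _
      exact sub_le_sub_left (pow_le_pow_left₀ hy.1 (hS y hy).2 r) 1
  · have := le_of_hasDerivAt_le (fun y _ => hasDerivAt_greedyDensity r y)
        (fun y hy => hasDerivAt_integral_hittingTime (d := d) hr (continuous_rootProb d r k true)
          (habs y hy)) (by simp [hzero]) (fun y hy => ?_) u ⟨hu0, le_rfl⟩
    · rwa [hu1] at this
    · have hpos := one_sub_pow_pos hr (habs y hy)
      rw [mul_one_div, le_div_iff₀ (by positivity), ← hdd]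
      have hmem := integral_treeProb_mem_Icc d r k false (hT y hy)
      refine pow_le_pow_left₀ hpos.le ?_ _
      exact sub_le_sub_left (pow_le_pow_left₀ hmem.1 (hS y hy).1 r) 1

/-! ### Independent uniform labels -/

/-- The uniform probability measure on the unit interval, as a measure on `ℝ`. -/
noncomputable def uniformMeasure : Measure ℝ := volume.restrict (Set.Ioc 0 1)

instance : IsProbabilityMeasure uniformMeasure := ⟨by simp [uniformMeasure]⟩

/-- The law of a family of independent labels, uniform on the unit interval. -/
noncomputable def labelMeasure (α : Type*) : Measure (α → ℝ) :=
  Measure.infinitePi fun _ => uniformMeasure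

instance (α : Type*) : IsProbabilityMeasure (labelMeasure α) := by
  unfold labelMeasure; infer_instance

variable {α : Type*}

lemma integral_uniformMeasure (f : ℝ → ℝ) : ∫ s, f s ∂uniformMeasure = ∫ s in (0 : ℝ)..1, f s := by
  rw [intervalIntegral.integral_of_le zero_le_one, uniformMeasure]

lemma integral_uniformMeasure_indicator_lt (f : ℝ → ℝ) {t : ℝ} (ht : t ∈ Set.Icc (0 : ℝ) 1) :
    ∫ s, (if s < t then f s else 0) ∂uniformMeasure = ∫ s in (0 : ℝ)..t, f s := by
  rw [intervalIntegral.integral_of_le ht.1, uniformMeasure]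
  have : (fun s => if s < t then f s else 0) = (Set.Iio t).indicator f := by
    ext s; simp [Set.indicator]
  rw [this, integral_indicator measurableSet_Iio, Measure.restrict_restrict measurableSet_Iio,
    integral_Ioc_eq_integral_Ioo]
  have : Set.Iio t ∩ Set.Ioc 0 1 = Set.Ioo 0 t := by
    ext s
    simp only [Set.mem_inter_iff, Set.mem_Iio, Set.mem_Ioc, Set.mem_Ioo]
    constructor
    · rintro ⟨h1, h2, h3⟩; exact ⟨h2, h1⟩
    · rintro ⟨h1, h2⟩; exact ⟨h2, h1, h2.le.trans ht.2⟩
  rw [this]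

lemma integral_uniformMeasure_indicator_gt (f : ℝ → ℝ) {t : ℝ} (ht : t ∈ Set.Icc (0 : ℝ) 1) :
    ∫ s, (if t < s then f s else 0) ∂uniformMeasure = ∫ s in t..1, f s := by
  rw [intervalIntegral.integral_of_le ht.2, uniformMeasure]
  have : (fun s => if t < s then f s else 0) = (Set.Ioi t).indicator f := by
    ext s; simp [Set.indicator]
  rw [this, integral_indicator measurableSet_Ioi, Measure.restrict_restrict measurableSet_Ioi]
  congr 2
  ext s
  simp only [Set.mem_inter_iff, Set.mem_Ioi, Set.mem_Ioc]
  constructor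
  · rintro ⟨h1, h2, h3⟩; exact ⟨h1, h3⟩
  · rintro ⟨h1, h2⟩; exact ⟨h1, ht.1.trans_lt h1, h2⟩

open Classical in
lemma measurable_piecewise_uncurry (S : Set α) :
    Measurable fun p : (α → ℝ) × (α → ℝ) => S.piecewise p.1 p.2 := by
  refine measurable_pi_iff.2 fun i => ?_
  by_cases hi : i ∈ S <;> simp only [Set.piecewise, hi, if_true, if_false] <;> fun_prop

open Classical in
/-- Gluing two independent families of labels along a set of coordinates gives such a family. -/
lemma map_piecewise_labelMeasure (S : Set α) :
    ((labelMeasure α).prod (labelMeasure α)).map (fun p => S.piecewise p.1 p.2)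
      = labelMeasure α := by
  have hm := measurable_piecewise_uncurry S
  refine Measure.eq_infinitePi _ fun s t ht => ?_
  rw [Measure.map_apply hm (MeasurableSet.pi s.countable_toSet fun i _ => ht i)]
  have : (fun p : (α → ℝ) × (α → ℝ) => S.piecewise p.1 p.2) ⁻¹' (Set.pi s t) =
      Set.pi ↑(s.filter (· ∈ S)) t ×ˢ Set.pi ↑(s.filter (· ∉ S)) t := by
    ext p
    simp only [Set.mem_preimage, Set.mem_pi, Set.mem_prod, Finset.coe_filter, Set.mem_ofPred_eq,
      Finset.mem_coe]
    constructor
    · intro h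
      exact ⟨fun i hi => by simpa [hi.2] using h i hi.1, fun i hi => by simpa [hi.2] using h i hi.1⟩
    · rintro ⟨h1, h2⟩ i hi
      by_cases hS : i ∈ S
      · simpa [hS] using h1 i ⟨hi, hS⟩
      · simpa [hS] using h2 i ⟨hi, hS⟩
  rw [this, Measure.prod_prod, labelMeasure, Measure.infinitePi_pi _ fun i _ => ht i,
    Measure.infinitePi_pi _ fun i _ => ht i, Finset.prod_filter_mul_prod_filter_not]

lemma measurable_update_uncurry [DecidableEq α] (v : α) :
    Measurable fun p : ℝ × (α → ℝ) => Function.update p.2 v p.1 := by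
  refine measurable_pi_iff.2 fun i => ?_
  by_cases hi : i = v
  · subst hi; simpa using measurable_fst
  · simp only [Function.update, hi, dite_false]; fun_prop

open Classical in
/-- Resampling one label does not change the law of the labels. -/
lemma map_update_labelMeasure (v : α) :
    (uniformMeasure.prod (labelMeasure α)).map (fun p => Function.update p.2 v p.1)
      = labelMeasure α := by
  have hm := measurable_update_uncurry v
  refine Measure.eq_infinitePi _ fun s t ht => ?_
  rw [Measure.map_apply hm (MeasurableSet.pi s.countable_toSet fun i _ => ht i)]
  have : (fun p : ℝ × (α → ℝ) => Function.update p.2 v p.1) ⁻¹' (Set.pi s t) =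
      (if v ∈ s then t v else Set.univ) ×ˢ Set.pi ↑(s.erase v) t := by
    ext p
    simp only [Set.mem_preimage, Set.mem_pi, Set.mem_prod, Finset.coe_erase, Finset.mem_coe,
      Set.mem_sdiff, Set.mem_singleton_iff]
    constructor
    · intro h
      refine ⟨?_, fun i hi => by simpa [hi.2] using h i hi.1⟩
      split_ifs with hv
      · simpa using h v hv
      · trivial
    · rintro ⟨h1, h2⟩ i hi
      by_cases hiv : i = v
      · subst hiv; simpa [hi] using h1
      · simpa [hiv] using h2 i ⟨hi, hiv⟩
  rw [this, Measure.prod_prod, labelMeasure, Measure.infinitePi_pi _ fun i _ => ht i]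
  split_ifs with hv
  · exact Finset.mul_prod_erase s (fun i => uniformMeasure (t i)) hv
  · rw [measure_univ, one_mul, Finset.erase_eq_of_notMem hv]

lemma integrable_of_mem_Icc {f : (α → ℝ) → ℝ} (hf : Measurable f) {C : ℝ}
    (h : ∀ x, f x ∈ Set.Icc 0 C) : Integrable f (labelMeasure α) := by
  refine Integrable.of_bound hf.aestronglyMeasurable C (Eventually.of_forall fun x => ?_)
  rw [Real.norm_of_nonneg (h x).1]
  exact (h x).2

/-- Conditioning on the label of `v`. -/
lemma integral_eq_integral_update [DecidableEq α] (v : α) {f : (α → ℝ) → ℝ} (hf : Measurable f)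
    {C : ℝ} (h : ∀ x, f x ∈ Set.Icc 0 C) :
    ∫ x, f x ∂labelMeasure α =
      ∫ s, (∫ x, f (Function.update x v s) ∂labelMeasure α) ∂uniformMeasure := by
  have hm := measurable_update_uncurry v
  have hmap : (uniformMeasure.prod (labelMeasure α)).map
      (fun p => Function.update p.2 v p.1) = labelMeasure α := by
    convert map_update_labelMeasure v
  rw [← hmap, integral_map hm.aemeasurable hf.aestronglyMeasurable, integral_prod, hmap]
  refine Integrable.of_bound (hf.comp hm).aestronglyMeasurable C (Eventually.of_forall fun x => ?_)
  rw [Real.norm_of_nonneg (h _).1]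
  exact (h _).2

/-- Functions of disjoint sets of labels are independent. -/
lemma integral_mul_of_dependsOn {f g : (α → ℝ) → ℝ} {S T : Set α} (hf : Measurable f)
    (hg : Measurable g) (hfS : DependsOn f S) (hgT : DependsOn g T) (hST : Disjoint S T) :
    ∫ x, f x * g x ∂labelMeasure α = (∫ x, f x ∂labelMeasure α) * ∫ x, g x ∂labelMeasure α := by
  classical
  have hm := measurable_piecewise_uncurry S
  calc ∫ x, f x * g x ∂labelMeasure α
      = ∫ p, f (S.piecewise p.1 p.2) * g (S.piecewise p.1 p.2)
          ∂((labelMeasure α).prod (labelMeasure α)) := by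
        conv_lhs => rw [← map_piecewise_labelMeasure S]
        exact integral_map hm.aemeasurable (hf.mul hg).aestronglyMeasurable
    _ = ∫ p, f p.1 * g p.2 ∂((labelMeasure α).prod (labelMeasure α)) := by
        congr 1
        ext p
        congr 1
        · exact hfS fun i hi => by simp [hi]
        · exact hgT fun i hi => by simp [Set.disjoint_right.1 hST hi]
    _ = _ := integral_prod_mul f g

lemma dependsOn_finset_prod {ι : Type*} (s : Finset ι) {f : ι → (α → ℝ) → ℝ} {S : ι → Set α}
    (h : ∀ i ∈ s, DependsOn (f i) (S i)) :
    DependsOn (fun x => ∏ i ∈ s, f i x) (⋃ i ∈ s, S i) := by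
  intro x y hxy
  exact Finset.prod_congr rfl fun i hi => h i hi fun j hj => hxy j (Set.mem_biUnion hi hj)

lemma integral_prod_of_dependsOn {ι : Type*} (s : Finset ι) {f : ι → (α → ℝ) → ℝ} {S : ι → Set α}
    (hf : ∀ i ∈ s, Measurable (f i)) (h : ∀ i ∈ s, DependsOn (f i) (S i))
    (hS : (s : Set ι).PairwiseDisjoint S) :
    ∫ x, ∏ i ∈ s, f i x ∂labelMeasure α = ∏ i ∈ s, ∫ x, f i x ∂labelMeasure α := by
  classical
  induction s using Finset.induction_on with
  | empty => simp
  | insert a s ha ih =>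
    simp only [Finset.prod_insert ha]
    rw [← ih (fun i hi => hf i (Finset.mem_insert_of_mem hi))
      (fun i hi => h i (Finset.mem_insert_of_mem hi))
      (hS.subset (by simp))]
    refine integral_mul_of_dependsOn (hf a (Finset.mem_insert_self _ _))
      (Finset.measurable_prod _ fun i hi => hf i (Finset.mem_insert_of_mem hi))
      (h a (Finset.mem_insert_self _ _))
      (dependsOn_finset_prod s fun i hi => h i (Finset.mem_insert_of_mem hi)) ?_
    refine Set.disjoint_iUnion₂_right.2 fun i hi => ?_
    exact hS (by simp) (by simp [hi]) (by rintro rfl; exact ha hi)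

lemma ae_pos (V : Finset α) : ∀ᵐ x ∂labelMeasure α, ∀ v ∈ V, 0 < x v := by
  rw [Filter.eventually_all_finset]
  intro v _
  have h : ∀ᵐ s ∂uniformMeasure, 0 < s := by
    filter_upwards [ae_restrict_mem measurableSet_Ioc] with s hs using hs.1
  exact (measurePreserving_eval_infinitePi (fun _ : α => uniformMeasure) v).quasiMeasurePreserving.ae h

/-- Almost surely, two distinct vertices have different labels. -/
lemma ae_ne_of_ne {v w : α} (hvw : v ≠ w) : ∀ᵐ x ∂labelMeasure α, x v ≠ x w := by
  classical
  have hms : MeasurableSet {x : α → ℝ | x v = x w} :=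
    measurableSet_eq_fun (measurable_pi_apply v) (measurable_pi_apply w)
  have hmap := map_update_labelMeasure v
  rw [ae_iff]
  simp only [ne_eq, not_not]
  rw [← hmap, Measure.map_apply (measurable_update_uncurry v) hms]
  rw [Measure.prod_apply_symm (measurable_update_uncurry v hms)]
  simp only [Set.preimage_ofPred_eq, Function.update_self, Function.update_of_ne hvw.symm]
  have : ∀ x : α → ℝ, uniformMeasure {s | s = x w} = 0 := by
    intro x
    simp [uniformMeasure]
  simp only [this, lintegral_zero]

lemma ae_injOn (V : Finset α) : ∀ᵐ x ∂labelMeasure α, Set.InjOn x V := by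
  have : ∀ᵐ x ∂labelMeasure α, ∀ v ∈ V, ∀ w ∈ V, v ≠ w → x v ≠ x w := by
    simp only [Filter.eventually_all_finset V, Filter.eventually_imp_distrib_left]
    exact fun v _ w _ hvw => ae_ne_of_ne hvw
  filter_upwards [this] with x hx v hv w hw h
  by_contra hne
  exact hx v hv w hw hne h

/-! ### The greedy process as an average over orders -/

section RandomOrder

open Classical

lemma formsEdgeWith_mono {G : Hypergraph α} {I J : Finset α} (h : I ⊆ J) {w : α}
    (hw : G.FormsEdgeWith I w) : G.FormsEdgeWith J w := by
  obtain ⟨e, he, hwe, hx⟩ := hw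
  exact ⟨e, he, hwe, fun x hxe => (hx x hxe).imp_right fun hI => h hI⟩

/-- The selected set after the vertex `v` has been inspected: `v` is added unless it forms an edge
with the vertices that have been selected before. -/
noncomputable def inspect (G : Hypergraph α) (I : Finset α) (v : α) : Finset α :=
  if G.FormsEdgeWith I v then I else insert v I

/-- The average of `F` over the sets obtained from `I` when the `n` vertices of `U` are inspected in
a uniformly random order. -/
noncomputable def orderAverage (G : Hypergraph α) (F : Finset α → ℝ) :
    ℕ → Finset α → Finset α → ℝ
  | 0, I, _ => F I
  | n + 1, I, U => ((n : ℝ) + 1)⁻¹ * ∑ v ∈ U, orderAverage G F n (inspect G I v) (U.erase v)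

/-- The value of `F` at the set obtained from `I` when the `n` vertices of `U` are inspected in the
order of their labels `x`. It is `0` if two of these labels coincide and `n ≥ 2`. -/
noncomputable def labelledRun (G : Hypergraph α) (F : Finset α → ℝ) :
    ℕ → Finset α → Finset α → (α → ℝ) → ℝ
  | 0, I, _, _ => F I
  | n + 1, I, U, x => ∑ v ∈ U, if ∀ w ∈ U.erase v, x v < x w then
      labelledRun G F n (inspect G I v) (U.erase v) x else 0

lemma greedyFrom_empty (G : Hypergraph α) (I : Finset α) : G.greedyFrom I ∅ = PMF.pure I := by
  rw [Hypergraph.greedyFrom, dif_neg Finset.not_nonempty_empty]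

lemma greedyFrom_apply (G : Hypergraph α) (I : Finset α) {R : Finset α} (hR : R.Nonempty)
    (J : Finset α) :
    (G.greedyFrom I R J).toReal = (R.card : ℝ)⁻¹ * ∑ v ∈ R,
      (G.greedyFrom (insert v I)
        ((R.erase v).filter fun w => ¬ G.FormsEdgeWith (insert v I) w) J).toReal := by
  rw [Hypergraph.greedyFrom, dif_pos hR, PMF.bindOnSupport_apply, tsum_eq_sum (s := R),
    ENNReal.toReal_sum, Finset.mul_sum]
  · refine Finset.sum_congr rfl fun v hv => ?_
    rw [PMF.uniformOfFinset_apply_of_mem _ hv, dif_neg (by simp), ENNReal.toReal_mul]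
    simp
  · intro v hv
    rw [PMF.uniformOfFinset_apply_of_mem _ hv, dif_neg (by simp)]
    exact ENNReal.mul_ne_top (by simpa using hR.ne_empty) (PMF.apply_ne_top _ _)
  · intro v hv
    rw [PMF.uniformOfFinset_apply_of_notMem _ hv, zero_mul]

/-- Inspecting vertices that can no longer be selected does not change the outcome, so that the
greedy algorithm may inspect all vertices in a uniformly random order. -/
lemma hasSum_greedyFrom (G : Hypergraph α) (F : Finset α → ℝ) (n : ℕ) :
    ∀ I U : Finset α, U.card = n →
      HasSum (fun J => (G.greedyFrom I (U.filter fun w => ¬ G.FormsEdgeWith I w) J).toReal * F J)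
        (orderAverage G F n I U) := by
  have hpure : ∀ I : Finset α, HasSum (fun J => (PMF.pure I J).toReal * F J) (F I) := by
    intro I
    convert! hasSum_single I (f := fun J => (PMF.pure I J).toReal * F J) fun J hJ => ?_ using 1
    · simp
    · simp [PMF.pure_apply, hJ]
  induction n with
  | zero =>
    intro I U hU
    rw [Finset.card_eq_zero.1 hU, Finset.filter_empty, greedyFrom_empty]
    exact hpure I
  | succ n ih =>
    intro I U hU
    set R := U.filter fun w => ¬ G.FormsEdgeWith I w with hR
    have herase : ∀ v ∈ U, (U.erase v).card = n := fun v hv => by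
      rw [Finset.card_erase_of_mem hv, hU]; rfl
    -- Inspecting a vertex that is no longer available leaves the state of the algorithm unchanged.
    have hout : ∀ v ∈ U, v ∉ R →
        HasSum (fun J => (G.greedyFrom I R J).toReal * F J)
          (orderAverage G F n (inspect G I v) (U.erase v)) := by
      intro v hv hvR
      have hforms : G.FormsEdgeWith I v := by
        by_contra h; exact hvR (Finset.mem_filter.2 ⟨hv, h⟩)
      have := ih I (U.erase v) (herase v hv)
      rw [Finset.filter_erase, ← hR, Finset.erase_eq_of_notMem hvR] at this
      rwa [inspect, if_pos hforms]
    have hin : ∀ v ∈ R, HasSum (fun J => (G.greedyFrom (insert v I)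
        ((R.erase v).filter fun w => ¬ G.FormsEdgeWith (insert v I) w) J).toReal * F J)
          (orderAverage G F n (inspect G I v) (U.erase v)) := by
      intro v hv
      obtain ⟨hvU, hforms⟩ := Finset.mem_filter.1 hv
      have := ih (insert v I) (U.erase v) (herase v hvU)
      rw [inspect, if_neg hforms]
      convert this using 6
      ext w
      simp only [Finset.mem_filter, Finset.mem_erase, hR]
      have := formsEdgeWith_mono (G := G) (Finset.subset_insert v I) (w := w)
      tauto
    have hn : (n : ℝ) + 1 ≠ 0 := by positivity
    rcases R.eq_empty_or_nonempty with hRe | hRne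
    · have hval : ∀ v ∈ U, orderAverage G F n (inspect G I v) (U.erase v) = F I := by
        intro v hv
        have := hout v hv (by simp [hRe])
        rw [hRe, greedyFrom_empty] at this
        exact this.unique (hpure I)
      rw [hRe, greedyFrom_empty, orderAverage, Finset.sum_congr rfl hval, Finset.sum_const, hU]
      convert hpure I using 1
      simp [hn]
    · set c := (R.card : ℝ)⁻¹ * ∑ v ∈ R, orderAverage G F n (inspect G I v) (U.erase v) with hc
      have hsum : HasSum (fun J => (G.greedyFrom I R J).toReal * F J) c := by
        have := (hasSum_sum hin).mul_left (R.card : ℝ)⁻¹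
        refine this.congr_fun fun J => ?_
        rw [greedyFrom_apply G I hRne, mul_assoc, Finset.sum_mul]
      have hRc : (R.card : ℝ) ≠ 0 := by
        exact_mod_cast (Finset.card_pos.2 hRne).ne'
      have hsplit : ∑ v ∈ U, orderAverage G F n (inspect G I v) (U.erase v) = (U.card : ℝ) * c := by
        have hRU : R ⊆ U := Finset.filter_subset _ _
        rw [← Finset.sum_sdiff hRU, Finset.sum_congr rfl fun v hv =>
          (hout v (Finset.mem_sdiff.1 hv).1 (Finset.mem_sdiff.1 hv).2).unique hsum,
          Finset.sum_const, nsmul_eq_mul]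
        have hcard : (U.card : ℝ) = (U \ R).card + R.card := by
          exact_mod_cast (Finset.card_sdiff_add_card_eq_card hRU).symm
        rw [hcard, add_mul]
        congr 1
        rw [hc]
        field_simp
      rw [orderAverage, hsplit, hU]
      convert hsum using 1
      push_cast
      field_simp

lemma labelledRun_congr (G : Hypergraph α) (F : Finset α → ℝ) (n : ℕ) :
    ∀ (I U : Finset α) (x y : α → ℝ), (∀ v ∈ U, x v = y v) →
      labelledRun G F n I U x = labelledRun G F n I U y := by
  induction n with
  | zero => intros; rfl
  | succ n ih =>
    intro I U x y h
    refine Finset.sum_congr rfl fun v hv => ?_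
    rw [ih _ (U.erase v) x y fun w hw => h w (Finset.mem_of_mem_erase hw)]
    have : (∀ w ∈ U.erase v, x v < x w) ↔ ∀ w ∈ U.erase v, y v < y w :=
      forall₂_congr fun w hw => by rw [h v hv, h w (Finset.mem_of_mem_erase hw)]
    simp only [this]

lemma measurableSet_forall_lt (U : Finset α) {f : (α → ℝ) → ℝ} (hf : Measurable f) :
    MeasurableSet {x : α → ℝ | ∀ w ∈ U, f x < x w} := by
  have : {x : α → ℝ | ∀ w ∈ U, f x < x w} = ⋂ w ∈ U, {x | f x < x w} := by ext; simp
  rw [this]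
  exact Finset.measurableSet_biInter _ fun w _ => measurableSet_lt hf (measurable_pi_apply w)

lemma measurable_labelledRun (G : Hypergraph α) (F : Finset α → ℝ) (n : ℕ) :
    ∀ I U : Finset α, Measurable (labelledRun G F n I U) := by
  induction n with
  | zero => intro I U; exact measurable_const
  | succ n ih =>
    intro I U
    exact Finset.measurable_sum _ fun v _ =>
      Measurable.ite (measurableSet_forall_lt _ (measurable_pi_apply v)) (ih _ _) measurable_const

lemma exists_labelledRun_mem_Icc (G : Hypergraph α) {F : Finset α → ℝ} (hF : ∀ J, 0 ≤ F J) (n : ℕ) :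
    ∀ I U : Finset α, ∃ C, ∀ x, labelledRun G F n I U x ∈ Set.Icc 0 C := by
  induction n with
  | zero => intro I U; exact ⟨F I, fun x => ⟨hF I, le_rfl⟩⟩
  | succ n ih =>
    intro I U
    choose C hC using fun v => ih (inspect G I v) (U.erase v)
    refine ⟨∑ v ∈ U, C v, fun x => ⟨Finset.sum_nonneg fun v _ => ?_,
      Finset.sum_le_sum fun v _ => ?_⟩⟩ <;> split_ifs
    · exact (hC v x).1
    · exact le_rfl
    · exact (hC v x).2
    · exact (hC v x).1.trans (hC v x).2

lemma integral_one_sub_pow (n : ℕ) (t : ℝ) :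
    ∫ s in t..1, (1 - s) ^ n = (1 - t) ^ (n + 1) / (n + 1) := by
  rw [intervalIntegral.integral_comp_sub_left (fun s => s ^ n) 1, integral_pow]
  simp

/-- Inspecting the vertices in the order of independent uniform labels amounts to inspecting them in
a uniformly random order. The restriction to labels exceeding `t` makes the induction on the number
of vertices work: after the first vertex, with label `s`, has been inspected, the remaining labels
are independent and exceed `s`. -/
lemma integral_labelledRun (G : Hypergraph α) {F : Finset α → ℝ} (hF : ∀ J, 0 ≤ F J) (n : ℕ) :
    ∀ I U : Finset α, U.card = n → ∀ t ∈ Set.Icc (0 : ℝ) 1,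
      ∫ x, (if ∀ w ∈ U, t < x w then labelledRun G F n I U x else 0) ∂labelMeasure α
        = (1 - t) ^ n * orderAverage G F n I U := by
  induction n with
  | zero =>
    intro I U hU t _
    simp [Finset.card_eq_zero.1 hU, labelledRun, orderAverage]
  | succ n ih =>
    intro I U hU t ht
    set g : α → (α → ℝ) → ℝ := fun v x =>
      if t < x v ∧ ∀ w ∈ U.erase v, x v < x w then
        labelledRun G F n (inspect G I v) (U.erase v) x else 0 with hg
    have hgm : ∀ v, Measurable (g v) := fun v =>
      Measurable.ite ((measurableSet_lt measurable_const (measurable_pi_apply v)).inter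
        (measurableSet_forall_lt _ (measurable_pi_apply v))) (measurable_labelledRun _ _ _ _ _)
        measurable_const
    have hgb : ∀ v, ∃ C, ∀ x, g v x ∈ Set.Icc 0 C := by
      intro v
      obtain ⟨C, hC⟩ := exists_labelledRun_mem_Icc G hF n (inspect G I v) (U.erase v)
      refine ⟨C, fun x => ?_⟩
      simp only [hg]
      split_ifs
      · exact hC x
      · exact ⟨le_rfl, (hC x).1.trans (hC x).2⟩
    have hsum : ∀ x, (if ∀ w ∈ U, t < x w then labelledRun G F (n + 1) I U x else 0)
        = ∑ v ∈ U, g v x := by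
      intro x
      by_cases h : ∀ w ∈ U, t < x w
      · rw [if_pos h]
        refine Finset.sum_congr rfl fun v hv => ?_
        simp [hg, h v hv]
      · rw [if_neg h]
        refine (Finset.sum_eq_zero fun v hv => if_neg ?_).symm
        rintro ⟨h1, h2⟩
        refine h fun w hw => ?_
        by_cases hwv : w = v
        · exact hwv ▸ h1
        · exact h1.trans (h2 w (Finset.mem_erase.2 ⟨hwv, hw⟩))
    have hint : ∀ v ∈ U, ∫ x, g v x ∂labelMeasure α = (1 - t) ^ (n + 1) / (n + 1) *
        orderAverage G F n (inspect G I v) (U.erase v) := by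
      intro v hv
      obtain ⟨C, hC⟩ := hgb v
      rw [integral_eq_integral_update v (hgm v) hC]
      have hupd : ∀ s : ℝ, ∫ x, g v (Function.update x v s) ∂labelMeasure α =
          if t < s then ∫ x, (if ∀ w ∈ U.erase v, s < x w then
            labelledRun G F n (inspect G I v) (U.erase v) x else 0) ∂labelMeasure α else 0 := by
        intro s
        have hs : ∀ x : α → ℝ, g v (Function.update x v s) = if t < s then
            (if ∀ w ∈ U.erase v, s < x w then
              labelledRun G F n (inspect G I v) (U.erase v) x else 0) else 0 := by
          intro x
          have h1 : (∀ w ∈ U.erase v, s < Function.update x v s w) ↔ ∀ w ∈ U.erase v, s < x w :=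
            forall₂_congr fun w hw => by rw [Function.update_of_ne (Finset.ne_of_mem_erase hw)]
          have h2 : labelledRun G F n (inspect G I v) (U.erase v) (Function.update x v s)
              = labelledRun G F n (inspect G I v) (U.erase v) x :=
            labelledRun_congr G F n _ _ _ _ fun w hw =>
              Function.update_of_ne (Finset.ne_of_mem_erase hw) _ _
          simp only [hg, Function.update_self, h1, h2, ite_and]
        simp only [hs]
        split_ifs <;> simp
      simp only [hupd]
      rw [integral_uniformMeasure_indicator_gt _ ht,
        intervalIntegral.integral_congr (g := fun s => (1 - s) ^ n *
          orderAverage G F n (inspect G I v) (U.erase v)),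
        intervalIntegral.integral_mul_const, integral_one_sub_pow]
      intro s hs
      rw [Set.uIcc_of_le ht.2] at hs
      exact ih _ _ (by rw [Finset.card_erase_of_mem hv, hU]; rfl) s ⟨ht.1.trans hs.1, hs.2⟩
    simp only [hsum]
    rw [integral_finsetSum _ fun v _ => ?_, Finset.sum_congr rfl hint, ← Finset.mul_sum,
      orderAverage]
    · ring
    · obtain ⟨C, hC⟩ := hgb v
      exact integrable_of_mem_Icc (hgm v) hC

/-- `J` is the set that is selected when the vertices of `V` are inspected in the order of their
labels `x`: a vertex is selected unless it forms an edge with selected vertices of smaller label. -/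
def IsSelection (G : Hypergraph α) (V : Finset α) (x : α → ℝ) (J : Finset α) : Prop :=
  J ⊆ V ∧ ∀ v ∈ V, v ∈ J ↔ ¬ G.FormsEdgeWith (J.filter fun w => x w < x v) v

lemma exists_isSelection (G : Hypergraph α) (V : Finset α) (x : α → ℝ) :
    ∃ J, IsSelection G V x J := by
  induction V using Finset.induction_on_max_value x with
  | empty => exact ⟨∅, by simp [IsSelection]⟩
  | insert a s ha hmax ih =>
    obtain ⟨J, hJs, hJ⟩ := ih
    have haJ : a ∉ J := fun h => ha (hJs h)
    by_cases hf : G.FormsEdgeWith (J.filter fun w => x w < x a) a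
    · refine ⟨J, hJs.trans (Finset.subset_insert _ _), fun v hv => ?_⟩
      rcases Finset.mem_insert.1 hv with rfl | hv
      · simp [haJ, hf]
      · exact hJ v hv
    · have hfilter : ∀ v, x v ≤ x a → ((insert a J).filter fun w => x w < x v) =
          J.filter fun w => x w < x v := fun v hv => by
        rw [Finset.filter_insert, if_neg (not_lt.2 hv)]
      refine ⟨insert a J, Finset.insert_subset_insert _ hJs, fun v hv => ?_⟩
      rcases Finset.mem_insert.1 hv with rfl | hv
      · simp [hfilter v le_rfl, hf]
      · rw [hfilter v (hmax v hv), ← hJ v hv, Finset.mem_insert]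
        have : v ≠ a := fun h => ha (h ▸ hv)
        simp [this]

/-- Inspecting the vertices in the order of distinct labels produces the selected set: when the
vertices of `U` remain, those selected so far are `J \ U`. -/
lemma labelledRun_eq_of_isSelection {G : Hypergraph α} {V : Finset α} {x : α → ℝ} {J : Finset α}
    (hJ : IsSelection G V x J) (hx : Set.InjOn x V) (F : Finset α → ℝ) (n : ℕ) :
    ∀ U ⊆ V, U.card = n → (∀ u ∈ U, ∀ w ∈ V, w ∉ U → x w < x u) →
      labelledRun G F n (J \ U) U x = F J := by
  induction n with
  | zero =>
    intro U _ hU _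
    simp [Finset.card_eq_zero.1 hU, labelledRun]
  | succ n ih =>
    intro U hUV hU hup
    obtain ⟨v, hv, hmin⟩ := Finset.exists_min_image U x (Finset.card_pos.1 (by omega))
    rw [labelledRun, Finset.sum_eq_single_of_mem v hv, if_pos]
    · have hfilter : (J.filter fun w => x w < x v) = J \ U := by
        ext w
        simp only [Finset.mem_filter, Finset.mem_sdiff]
        refine and_congr_right fun hw => ⟨fun h hwU => ?_, fun h => hup v hv w (hJ.1 hw) h⟩
        exact absurd (hmin w hwU) (not_le.2 h)
      have hnext : inspect G (J \ U) v = J \ U.erase v := by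
        have := hJ.2 v (hUV hv)
        rw [hfilter] at this
        unfold inspect
        split_ifs with hf
        · have hvJ : v ∉ J := by simpa [hf] using this
          ext w
          by_cases hwv : w = v
          · subst hwv; simp [hvJ]
          · simp [hwv]
        · have hvJ : v ∈ J := by simpa [hf] using this
          ext w
          by_cases hwv : w = v
          · subst hwv; simp [hvJ]
          · simp [hwv]
      rw [hnext]
      refine ih _ ((Finset.erase_subset _ _).trans hUV)
        (by rw [Finset.card_erase_of_mem hv, hU]; rfl) fun u hu w hw hwU => ?_
      have huU := Finset.mem_of_mem_erase hu
      by_cases hwv : w = v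
      · subst hwv
        refine lt_of_le_of_ne (hmin u huU) fun h => ?_
        exact Finset.ne_of_mem_erase hu (hx (hUV huU) hw h.symm)
      · exact hup u huU w hw fun h => hwU (Finset.mem_erase.2 ⟨hwv, h⟩)
    · intro w hw
      have hwU := Finset.mem_of_mem_erase hw
      refine lt_of_le_of_ne (hmin w hwU) fun h => ?_
      exact Finset.ne_of_mem_erase hw (hx (hUV hwU) (hUV hv) h.symm)
    · intro w hw hwv
      refine if_neg fun h => ?_
      exact absurd (hmin w hw) (not_le.2 (h v (Finset.mem_erase.2 ⟨hwv.symm, hv⟩)))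

/-- The set selected in the order of distinct labels is independent. -/
lemma IsSelection.isIndependent {G : Hypergraph α} (hG : G.vertexSet.Finite) {x : α → ℝ}
    {J : Finset α} (hJ : IsSelection G hG.toFinset x J) (hx : Set.InjOn x G.vertexSet)
    (hne : ∀ e ∈ G.edgeSet, e.Nonempty) : G.IsIndependent (J : Set α) := by
  have hJV : (J : Set α) ⊆ G.vertexSet := fun v hv => hG.mem_toFinset.1 (hJ.1 hv)
  refine ⟨hJV, fun e he heJ => ?_⟩
  have hefin : e.Finite := J.finite_toSet.subset heJ
  obtain ⟨v, hv, hmax⟩ := hefin.exists_maximalFor x e (hne e he)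
  refine (hJ.2 v (hJ.1 (heJ hv))).1 (heJ hv) ⟨e, he, hv, fun w hw => ?_⟩
  by_cases hwv : w = v
  · exact Or.inl hwv
  · refine Or.inr (Finset.mem_filter.2 ⟨heJ hw, ?_⟩)
    refine lt_of_le_of_ne ?_ fun h => hwv (hx (hJV (heJ hw)) (hJV (heJ hv)) h)
    by_contra h
    exact h (hmax hw (not_le.1 h).le)

lemma IsSelection.card_le_indepNumber {G : Hypergraph α} (hG : G.vertexSet.Finite) {x : α → ℝ}
    {J : Finset α} (hJ : IsSelection G hG.toFinset x J) (hx : Set.InjOn x G.vertexSet)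
    (hne : ∀ e ∈ G.edgeSet, e.Nonempty) : J.card ≤ G.indepNumber := by
  refine le_csSup ⟨G.vertexSet.ncard, ?_⟩ ⟨J, hJ.isIndependent hG hx hne, Set.ncard_coe_finset J⟩
  rintro k ⟨S, hS, rfl⟩
  exact Set.ncard_le_ncard hS.1 hG

/-- The size of the set produced by the greedy algorithm, as a function of the labels. -/
noncomputable def selectionSize (G : Hypergraph α) (V : Finset α) (x : α → ℝ) : ℝ :=
  labelledRun G (fun J => (J.card : ℝ)) V.card ∅ V x

lemma selectionSize_eq {G : Hypergraph α} {V : Finset α} {x : α → ℝ} {J : Finset α}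
    (hJ : IsSelection G V x J) (hx : Set.InjOn x V) : selectionSize G V x = J.card := by
  have := labelledRun_eq_of_isSelection hJ hx (fun J => (J.card : ℝ)) _ V subset_rfl rfl
    fun u _ w hw hwV => absurd hw hwV
  rwa [Finset.sdiff_eq_empty_iff_subset.2 hJ.1] at this

lemma integrable_selectionSize (G : Hypergraph α) (V : Finset α) :
    Integrable (selectionSize G V) (labelMeasure α) := by
  obtain ⟨C, hC⟩ := exists_labelledRun_mem_Icc G (F := fun J => (J.card : ℝ))
    (fun J => Nat.cast_nonneg _) V.card ∅ V
  exact integrable_of_mem_Icc (measurable_labelledRun _ _ _ _ _) hC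

lemma formsEdgeWith_empty {G : Hypergraph α} {r : ℕ} (hr : 1 ≤ r) (hu : G.IsUniform (r + 1)) (w : α) :
    ¬ G.FormsEdgeWith ∅ w := by
  rintro ⟨e, he, -, hx⟩
  have : e ⊆ {w} := fun x hxe => (hx x hxe).resolve_right (by simp)
  have := Set.ncard_le_ncard this
  rw [hu e he, Set.ncard_singleton] at this
  omega

lemma greedyExpectedSize_eq_integral {G : Hypergraph α} (hG : G.vertexSet.Finite) {r : ℕ}
    (hr : 1 ≤ r) (hu : G.IsUniform (r + 1)) :
    G.greedyExpectedSize hG = ∫ x, selectionSize G hG.toFinset x ∂labelMeasure α := by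
  have h1 := hasSum_greedyFrom G (fun J => (J.card : ℝ)) _ ∅ hG.toFinset rfl
  rw [Finset.filter_true_of_mem fun w _ => formsEdgeWith_empty hr hu w] at h1
  have h2 := integral_labelledRun G (F := fun J => (J.card : ℝ)) (fun J => Nat.cast_nonneg _) _ ∅
    hG.toFinset rfl 0 (by simp)
  rw [sub_zero, one_pow, one_mul] at h2
  rw [Hypergraph.greedyExpectedSize, Hypergraph.greedy, h1.tsum_eq, ← h2]
  refine integral_congr_ae ?_
  filter_upwards [ae_pos hG.toFinset] with x hx
  rw [if_pos hx, selectionSize]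

end RandomOrder

/-! ### Non-backtracking walks and the girth -/

/-- `NonBacktracking E m x f l y`: there is a walk of `m ≥ 1` steps from `x` to `y` through edges
from `E`, the first of which is `f` and the last of which is `l`, such that consecutive vertices are
distinct and consecutive edges are distinct. -/
inductive NonBacktracking (E : Finset (Finset α)) : ℕ → α → Finset α → Finset α → α → Prop
  | single {x y : α} {e : Finset α} : e ∈ E → x ∈ e → y ∈ e → x ≠ y → NonBacktracking E 1 x e e y
  | cons {m : ℕ} {x y z : α} {e f l : Finset α} : e ∈ E → x ∈ e → y ∈ e → x ≠ y → e ≠ f →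
      NonBacktracking E m y f l z → NonBacktracking E (m + 1) x e l z

namespace NonBacktracking

variable {E : Finset (Finset α)}

lemma append {m n : ℕ} {x y z : α} {f l f' l' : Finset α} (h : NonBacktracking E m x f l y)
    (h' : NonBacktracking E n y f' l' z) (hl : l ≠ f') : NonBacktracking E (m + n) x f l' z := by
  induction h with
  | single he hx hy hxy => rw [add_comm]; exact cons he hx hy hxy hl h'
  | cons he hx hy hxy hef _ ih => rw [add_right_comm]; exact cons he hx hy hxy hef (ih h' hl)

lemma reverse {m : ℕ} {x y : α} {f l : Finset α} (h : NonBacktracking E m x f l y) :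
    NonBacktracking E m y l f x := by
  induction h with
  | single he hx hy hxy => exact single he hy hx hxy.symm
  | cons he hx hy hxy hef _ ih => exact ih.append (single he hy hx hxy.symm) hef.symm

lemma exists_sequences {m : ℕ} {x y : α} {f l : Finset α} (h : NonBacktracking E m x f l y) :
    ∃ (v : ℕ → α) (e : ℕ → Finset α), 1 ≤ m ∧ v 0 = x ∧ v m = y ∧ e 0 = f ∧
      (∀ i < m, e i ∈ E ∧ v i ∈ e i ∧ v (i + 1) ∈ e i ∧ v i ≠ v (i + 1)) ∧
      ∀ i, i + 1 < m → e i ≠ e (i + 1) := by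
  induction h with
  | @single x y e he hx hy hxy =>
    refine ⟨fun i => if i = 0 then x else y, fun _ => e, le_rfl, by simp, by simp, rfl, ?_, ?_⟩
    · intro i hi
      obtain rfl : i = 0 := by omega
      simpa using ⟨he, hx, hy, hxy⟩
    · intro i hi; omega
  | @cons m x y z e f l he hx hy hxy hef _ ih =>
    obtain ⟨v, c, hm, h0, hend, hf, hstep, hne⟩ := ih
    refine ⟨fun i => Nat.casesOn i x v, fun i => Nat.casesOn i e c, by omega, rfl, hend, rfl, ?_, ?_⟩
    · rintro (_ | i) hi
      · exact ⟨he, hx, by simpa [h0] using hy, by simpa [h0] using hxy⟩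
      · exact hstep i (by omega)
    · rintro (_ | i) hi
      · simpa [hf] using hef
      · exact hne i (by omega)

end NonBacktracking

/-- A closed non-backtracking walk yields a Berge cycle that is not longer: a repeated vertex or a
repeated edge gives a shorter closed walk. -/
lemma exists_hasBergeCycle_of_closed {G : Hypergraph α} (m : ℕ) :
    ∀ (v : ℕ → α) (e : ℕ → Finset α), 1 ≤ m →
      (∀ i < m, (e i : Set α) ∈ G.edgeSet ∧ v i ∈ e i ∧ v (i + 1) ∈ e i ∧ v i ≠ v (i + 1)) →
      (∀ i, i + 1 < m → e i ≠ e (i + 1)) → v m = v 0 → ∃ k ≤ m, G.HasBergeCycle k := by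
  induction m using Nat.strong_induction_on with
  | _ m ih =>
    intro v e hm hstep hne hclosed
    by_cases hv : ∃ i j, i < j ∧ j < m ∧ v i = v j
    · obtain ⟨i, j, hij, hjm, hvij⟩ := hv
      obtain ⟨k, hk, hc⟩ := ih (j - i) (by omega) (fun n => v (i + n)) (fun n => e (i + n)) (by omega)
        (fun n hn => hstep (i + n) (by omega)) (fun n hn => hne (i + n) (by omega))
        (by simp [Nat.add_sub_cancel' hij.le, hvij])
      exact ⟨k, by omega, hc⟩
    have hinj : ∀ i j, i < j → j < m → v i ≠ v j := fun i j h1 h2 h3 => hv ⟨i, j, h1, h2, h3⟩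
    by_cases he : ∃ a b, a < b ∧ b < m ∧ e a = e b
    · obtain ⟨a, b, hab, hbm, heab⟩ := he
      -- The common edge joins `v b` to `v (a + 1)` and so closes the walk between these vertices.
      have hab' : a + 1 ≠ b := by
        rintro rfl; exact hne a hbm heab
      have hstep' : ∀ n < b - a, (e (a + 1 + n) : Set α) ∈ G.edgeSet ∧
          (if n < b - a then v (a + 1 + n) else v (a + 1)) ∈ e (a + 1 + n) ∧
          (if n + 1 < b - a then v (a + 1 + (n + 1)) else v (a + 1)) ∈ e (a + 1 + n) ∧
          (if n < b - a then v (a + 1 + n) else v (a + 1)) ≠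
            (if n + 1 < b - a then v (a + 1 + (n + 1)) else v (a + 1)) := by
        intro n hn
        have hs := hstep (a + 1 + n) (by omega)
        rw [if_pos hn]
        by_cases hn' : n + 1 < b - a
        · rw [if_pos hn']; exact hs
        · obtain rfl : b = a + 1 + n := by omega
          rw [if_neg hn']
          refine ⟨hs.1, hs.2.1, heab ▸ (hstep a (by omega)).2.2.1, ?_⟩
          exact (hinj (a + 1) (a + 1 + n) (by omega) hbm).symm
      obtain ⟨k, hk, hc⟩ := ih (b - a) (by omega)
        (fun n => if n < b - a then v (a + 1 + n) else v (a + 1)) (fun n => e (a + 1 + n)) (by omega)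
        hstep' (fun n hn => hne (a + 1 + n) (by omega)) (by simp [hab])
      exact ⟨k, by omega, hc⟩
    have hm2 : 2 ≤ m := by
      by_contra h
      obtain rfl : m = 1 := by omega
      exact (hstep 0 (by omega)).2.2.2 hclosed.symm
    have hinjOn : ∀ {β : Type _} (f : ℕ → β), (∀ i j, i < j → j < m → f i ≠ f j) →
        Set.InjOn f (Set.Iio m) := by
      intro β f hf i hi j hj hij
      rcases lt_trichotomy i j with h | h | h
      · exact absurd hij (hf i j h hj)
      · exact h
      · exact absurd hij.symm (hf j i h hi)
    refine ⟨m, le_rfl, hm2, v, fun i => (e i : Set α), hinjOn v hinj,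
      hinjOn _ fun a b hab hb h => he ⟨a, b, hab, hb, Finset.coe_injective h⟩, hclosed,
      fun i hi => ?_⟩
    exact ⟨(hstep i hi).1, (hstep i hi).2.1, (hstep i hi).2.2.1⟩

open Classical in
/-- The edges of a hypergraph with finitely many vertices, as a finite set of finite sets. -/
noncomputable def edgeFinset (G : Hypergraph α) (hG : G.vertexSet.Finite) : Finset (Finset α) :=
  hG.toFinset.powerset.filter fun e => (e : Set α) ∈ G.edgeSet

lemma mem_edgeFinset {G : Hypergraph α} {hG : G.vertexSet.Finite} {e : Finset α} :
    e ∈ edgeFinset G hG ↔ (e : Set α) ∈ G.edgeSet := by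
  simp only [edgeFinset, Finset.mem_filter, Finset.mem_powerset, and_iff_right_iff_imp]
  intro he x hx
  exact hG.mem_toFinset.2 (G.subset_vertexSet_of_mem_edgeSet he hx)

lemma exists_coe_eq_of_mem_edgeSet {G : Hypergraph α} (hG : G.vertexSet.Finite) {e : Set α}
    (he : e ∈ G.edgeSet) : ∃ f ∈ edgeFinset G hG, (f : Set α) = e := by
  have hfin := hG.subset (G.subset_vertexSet_of_mem_edgeSet he)
  refine ⟨hfin.toFinset, mem_edgeFinset.2 ?_, ?_⟩ <;> simp [he]

lemma le_of_nonBacktracking_closed {G : Hypergraph α} {hG : G.vertexSet.Finite} {g : ℕ}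
    (hg : G.HasGirth g) {m : ℕ} {x : α} {f l : Finset α}
    (h : NonBacktracking (edgeFinset G hG) m x f l x) : g ≤ m := by
  obtain ⟨v, e, hm, h0, hend, -, hstep, hne⟩ := h.exists_sequences
  obtain ⟨k, hk, hc⟩ := exists_hasBergeCycle_of_closed m v e hm
    (fun i hi => ⟨mem_edgeFinset.1 (hstep i hi).1, (hstep i hi).2⟩) hne (hend.trans h0.symm)
  exact (hg.2 hc).trans hk

/-! ### Selection in truncated neighbourhoods -/

section Tree

open Classical

/-- The vertices that a non-backtracking walk of at most `k` steps from `w` can reach if its first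
edge is not `P`. -/
def reach (E : Finset (Finset α)) (k : ℕ) (P : Finset α) (w : α) : Set α :=
  {y | y = w ∨ ∃ j ≤ k, ∃ f l, f ≠ P ∧ NonBacktracking E j w f l y}

/-- The recursive rule for the selection of `w` among the vertices beyond the edge `P`, truncated
after `k` steps. At the truncation depth the recursion returns `1` or `0`; as the rule is antitone,
the flag is flipped at each step, so that `true` gives an upper and `false` a lower bound of the
indicator of the selection of `w`. -/
noncomputable def treeIndicator (E : Finset (Finset α)) :
    ℕ → Bool → Finset α → α → (α → ℝ) → ℝ
  | 0, b, _, _, _ => if b then 1 else 0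
  | k + 1, b, P, w, x => ∏ e ∈ (E.filter (w ∈ ·)).erase P,
      (1 - ∏ w' ∈ e.erase w, if x w' < x w then treeIndicator E k (!b) e w' x else 0)

variable {E : Finset (Finset α)}

lemma ite_mem_Icc {p : Prop} [Decidable p] {a : ℝ} (ha : a ∈ Set.Icc (0 : ℝ) 1) :
    (if p then a else 0) ∈ Set.Icc (0 : ℝ) 1 := by
  split_ifs
  · exact ha
  · simp

lemma prod_mem_Icc {ι : Type*} {s : Finset ι} {f : ι → ℝ} (h : ∀ i ∈ s, f i ∈ Set.Icc (0 : ℝ) 1) :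
    ∏ i ∈ s, f i ∈ Set.Icc (0 : ℝ) 1 :=
  ⟨Finset.prod_nonneg fun i hi => (h i hi).1,
    Finset.prod_le_one (fun i hi => (h i hi).1) fun i hi => (h i hi).2⟩

lemma one_sub_mem_Icc {a : ℝ} (ha : a ∈ Set.Icc (0 : ℝ) 1) : 1 - a ∈ Set.Icc (0 : ℝ) 1 :=
  ⟨by linarith [ha.2], by linarith [ha.1]⟩

lemma treeIndicator_mem_Icc (k : ℕ) : ∀ (b : Bool) (P : Finset α) (w : α) (x : α → ℝ),
    treeIndicator E k b P w x ∈ Set.Icc (0 : ℝ) 1 := by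
  induction k with
  | zero => intro b P w x; cases b <;> simp [treeIndicator]
  | succ k ih =>
    intro b P w x
    exact prod_mem_Icc fun e _ => one_sub_mem_Icc (prod_mem_Icc fun w' _ => ite_mem_Icc (ih _ _ _ _))

lemma measurable_treeIndicator (k : ℕ) : ∀ (b : Bool) (P : Finset α) (w : α),
    Measurable (treeIndicator E k b P w) := by
  induction k with
  | zero => intro b P w; exact measurable_const
  | succ k ih =>
    intro b P w
    exact Finset.measurable_prod _ fun e _ => measurable_const.sub <|
      Finset.measurable_prod _ fun w' _ => Measurable.ite
        (measurableSet_lt (measurable_pi_apply w') (measurable_pi_apply w)) (ih _ _ _) measurable_const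

lemma mem_reach_self (k : ℕ) (P : Finset α) (w : α) : w ∈ reach E k P w := Or.inl rfl

/-- Stepping back from `w'` to `w` through the forbidden edge `e` extends the walks that define
`reach E k e w'`. -/
lemma exists_nonBacktracking_of_mem_reach {k : ℕ} {e : Finset α} {w w' y : α} (he : e ∈ E)
    (hw : w ∈ e) (hw' : w' ∈ e) (hne : w ≠ w') (hy : y ∈ reach E k e w') :
    ∃ j ≤ k + 1, ∃ l, NonBacktracking E j w e l y := by
  rcases hy with rfl | ⟨j, hj, f, l, hf, hwalk⟩
  · exact ⟨1, by omega, e, .single he hw hw' hne⟩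
  · exact ⟨j + 1, by omega, l, .cons he hw hw' hne hf.symm hwalk⟩

lemma dependsOn_treeIndicator (k : ℕ) : ∀ (b : Bool) (P : Finset α) (w : α),
    DependsOn (treeIndicator E k b P w) (reach E k P w) := by
  induction k with
  | zero => intro b P w x y _; rfl
  | succ k ih =>
    intro b P w x y hxy
    refine Finset.prod_congr rfl fun e he => ?_
    obtain ⟨heP, he⟩ := Finset.mem_erase.1 he
    obtain ⟨heE, hwe⟩ := Finset.mem_filter.1 he
    congr 1
    refine Finset.prod_congr rfl fun w' hw' => ?_
    obtain ⟨hne, hw'e⟩ := Finset.mem_erase.1 hw'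
    have hsub : ∀ z ∈ reach E k e w', x z = y z := by
      intro z hz
      obtain ⟨j, hj, l, hwalk⟩ := exists_nonBacktracking_of_mem_reach heE hwe hw'e hne.symm hz
      exact hxy z (Or.inr ⟨j, hj, e, l, heP, hwalk⟩)
    rw [ih (!b) e w' hsub, hsub w' (mem_reach_self _ _ _), hxy w (mem_reach_self _ _ _)]

/-- Once the label of `w` has been fixed, the recursion at `w` combines functions of the labels
beyond `w`. -/
lemma treeIndicator_update {g : ℕ}
    (hgirth : ∀ (m : ℕ) (x : α) (f l : Finset α), NonBacktracking E m x f l x → g ≤ m)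
    {k : ℕ} (hk : k + 1 < g) (b : Bool) (P : Finset α) (w : α) (x : α → ℝ) (t : ℝ) :
    treeIndicator E (k + 1) b P w (Function.update x w t) =
      ∏ e ∈ (E.filter (w ∈ ·)).erase P,
        (1 - ∏ w' ∈ e.erase w, if x w' < t then treeIndicator E k (!b) e w' x else 0) := by
  refine Finset.prod_congr rfl fun e he => ?_
  obtain ⟨heE, hwe⟩ := Finset.mem_filter.1 (Finset.mem_of_mem_erase he)
  congr 1
  refine Finset.prod_congr rfl fun w' hw' => ?_
  obtain ⟨hne, hw'e⟩ := Finset.mem_erase.1 hw'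
  rw [Function.update_self, Function.update_of_ne hne]
  have : treeIndicator E k (!b) e w' (Function.update x w t) = treeIndicator E k (!b) e w' x := by
    refine dependsOn_treeIndicator k (!b) e w' fun z hz => Function.update_of_ne ?_ _ _
    rintro rfl
    obtain ⟨j, hj, l, hwalk⟩ := exists_nonBacktracking_of_mem_reach heE hwe hw'e hne.symm hz
    have := hgirth _ _ _ _ hwalk
    omega
  rw [this]

/-- A common vertex beyond two vertices of one edge would close a walk of at most `2 k + 1` steps. -/
lemma disjoint_reach_of_ne {g : ℕ}
    (hgirth : ∀ (m : ℕ) (x : α) (f l : Finset α), NonBacktracking E m x f l x → g ≤ m)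
    {k : ℕ} (hk : 2 * (k + 1) < g) {e : Finset α} (he : e ∈ E) {v w : α} (hv : v ∈ e) (hw : w ∈ e)
    (hvw : v ≠ w) : Disjoint (reach E k e v) (reach E k e w) := by
  refine Set.disjoint_left.2 fun y hyv hyw => ?_
  obtain ⟨j, hj, l, hwalk⟩ := exists_nonBacktracking_of_mem_reach he hv hw hvw hyw
  rcases hyv with rfl | ⟨i, hi, f, l', hf, hwalk'⟩
  · have := hgirth _ _ _ _ hwalk
    omega
  · have := hgirth _ _ _ _ (hwalk'.reverse.append hwalk hf)
    omega

/-- A common vertex beyond two edges at `u` would close a walk of at most `2 k + 2` steps. -/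
lemma disjoint_reach_of_edge_ne {g : ℕ}
    (hgirth : ∀ (m : ℕ) (x : α) (f l : Finset α), NonBacktracking E m x f l x → g ≤ m)
    {k : ℕ} (hk : 2 * (k + 1) < g) {e f : Finset α} (he : e ∈ E) (hf : f ∈ E) (hef : e ≠ f)
    {u v w : α} (hue : u ∈ e) (huf : u ∈ f) (hv : v ∈ e) (hw : w ∈ f) (huv : u ≠ v) (huw : u ≠ w) :
    Disjoint (reach E k e v) (reach E k f w) := by
  refine Set.disjoint_left.2 fun y hyv hyw => ?_
  obtain ⟨i, hi, l, hwalk⟩ := exists_nonBacktracking_of_mem_reach he hue hv huv hyv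
  obtain ⟨j, hj, l', hwalk'⟩ := exists_nonBacktracking_of_mem_reach hf huf hw huw hyw
  have := hgirth _ _ _ _ (hwalk.reverse.append hwalk' hef)
  omega

/-- By the girth condition the subtrees below `w` are disjoint, so that the recursion turns into one
for probabilities. -/
lemma integral_treeIndicator_update_succ {g : ℕ}
    (hgirth : ∀ (m : ℕ) (x : α) (f l : Finset α), NonBacktracking E m x f l x → g ≤ m)
    {d r k : ℕ} (hk : 2 * (k + 1) < g) (hunif : ∀ e ∈ E, e.card = r + 1)
    (ih : ∀ (b : Bool), ∀ e ∈ E, ∀ w ∈ e, ∀ s ∈ Set.Icc (0 : ℝ) 1,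
      ∫ x, treeIndicator E k b e w (Function.update x w s) ∂labelMeasure α = treeProb d r k b s)
    (b : Bool) (P : Finset α) (w : α) {t : ℝ} (ht : t ∈ Set.Icc (0 : ℝ) 1) :
    ∫ x, treeIndicator E (k + 1) b P w (Function.update x w t) ∂labelMeasure α
      = (1 - (∫ s in (0 : ℝ)..t, treeProb d r k (!b) s) ^ r) ^
          ((E.filter (w ∈ ·)).erase P).card := by
  simp only [treeIndicator_update hgirth (show k + 1 < g by omega)]
  set h : Finset α → α → (α → ℝ) → ℝ := fun e w' x =>
    if x w' < t then treeIndicator E k (!b) e w' x else 0 with hh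
  have hmeas : ∀ e w', Measurable (h e w') := fun e w' =>
    Measurable.ite (measurableSet_lt (measurable_pi_apply w') measurable_const)
      (measurable_treeIndicator _ _ _ _) measurable_const
  have hIcc : ∀ e w' x, h e w' x ∈ Set.Icc (0 : ℝ) 1 := fun e w' x =>
    ite_mem_Icc (treeIndicator_mem_Icc _ _ _ _ _)
  have hdep : ∀ e w', DependsOn (h e w') (reach E k e w') := by
    intro e w' x y hxy
    simp only [hh, dependsOn_treeIndicator k (!b) e w' hxy, hxy w' (mem_reach_self _ _ _)]
  have hsingle : ∀ e ∈ E, ∀ w' ∈ e,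
      ∫ x, h e w' x ∂labelMeasure α = ∫ s in (0 : ℝ)..t, treeProb d r k (!b) s := by
    intro e he w' hw'
    rw [integral_eq_integral_update w' (hmeas e w') (hIcc e w')]
    have : ∀ s, ∫ x, h e w' (Function.update x w' s) ∂labelMeasure α = if s < t then
        ∫ x, treeIndicator E k (!b) e w' (Function.update x w' s) ∂labelMeasure α else 0 := by
      intro s
      simp only [hh, Function.update_self]
      split_ifs <;> simp
    simp only [this]
    rw [integral_uniformMeasure_indicator_lt _ ht]
    refine intervalIntegral.integral_congr fun s hs => ?_
    rw [Set.uIcc_of_le ht.1] at hs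
    exact ih _ e he w' hw' s ⟨hs.1, hs.2.trans ht.2⟩
  have hedge : ∀ e ∈ (E.filter (w ∈ ·)).erase P,
      ∫ x, (1 - ∏ w' ∈ e.erase w, h e w' x) ∂labelMeasure α
        = 1 - (∫ s in (0 : ℝ)..t, treeProb d r k (!b) s) ^ r := by
    intro e he
    obtain ⟨heE, hwe⟩ := Finset.mem_filter.1 (Finset.mem_of_mem_erase he)
    rw [integral_sub (integrable_const _), integral_prod_of_dependsOn _ (fun w' _ => hmeas e w')
      (fun w' _ => hdep e w'), Finset.prod_congr rfl fun w' hw' =>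
        hsingle e heE w' (Finset.mem_of_mem_erase hw'), Finset.prod_const,
      Finset.card_erase_of_mem hwe, hunif e heE]
    · simp
    · intro v hv v' hv' hne
      exact disjoint_reach_of_ne hgirth hk heE (Finset.mem_of_mem_erase hv)
        (Finset.mem_of_mem_erase hv') hne
    · exact integrable_of_mem_Icc (Finset.measurable_prod _ fun w' _ => hmeas e w')
        fun x => prod_mem_Icc fun w' _ => hIcc e w' x
  rw [integral_prod_of_dependsOn (f := fun e x => 1 - ∏ w' ∈ e.erase w, h e w' x)
    (S := fun e => ⋃ w' ∈ e.erase w, reach E k e w') _ (fun e _ => measurable_const.sub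
      (Finset.measurable_prod _ fun w' _ => hmeas e w')) ?_ ?_,
    Finset.prod_congr rfl hedge, Finset.prod_const]
  · intro e _ x y hxy
    exact congrArg (1 - ·) (dependsOn_finset_prod (e.erase w) (fun w' _ => hdep e w') hxy)
  · intro e he f hf hef
    obtain ⟨heE, hwe⟩ := Finset.mem_filter.1 (Finset.mem_of_mem_erase he)
    obtain ⟨hfE, hwf⟩ := Finset.mem_filter.1 (Finset.mem_of_mem_erase hf)
    refine Set.disjoint_iUnion₂_left.2 fun v hv => Set.disjoint_iUnion₂_right.2 fun v' hv' => ?_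
    obtain ⟨hvw, hv⟩ := Finset.mem_erase.1 hv
    obtain ⟨hvw', hv'⟩ := Finset.mem_erase.1 hv'
    exact disjoint_reach_of_edge_ne hgirth hk heE hfE hef hwe hwf hv hv' hvw.symm hvw'.symm

lemma integral_treeIndicator_update {g : ℕ}
    (hgirth : ∀ (m : ℕ) (x : α) (f l : Finset α), NonBacktracking E m x f l x → g ≤ m)
    {d r : ℕ} (hunif : ∀ e ∈ E, e.card = r + 1)
    (hreg : ∀ e ∈ E, ∀ w ∈ e, (E.filter (w ∈ ·)).card = d) (k : ℕ) (hk : 2 * k < g) :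
    ∀ (b : Bool), ∀ e ∈ E, ∀ w ∈ e, ∀ s ∈ Set.Icc (0 : ℝ) 1,
      ∫ x, treeIndicator E k b e w (Function.update x w s) ∂labelMeasure α = treeProb d r k b s := by
  induction k with
  | zero => intro b e _ w _ s _; simp [treeIndicator, treeProb]
  | succ k ih =>
    intro b e he w hw s hs
    rw [integral_treeIndicator_update_succ hgirth hk hunif (ih (by omega)) b e w hs,
      Finset.card_erase_of_mem (Finset.mem_filter.2 ⟨he, hw⟩), hreg e he w hw, treeProb]

lemma integral_treeIndicator_root {g : ℕ}
    (hgirth : ∀ (m : ℕ) (x : α) (f l : Finset α), NonBacktracking E m x f l x → g ≤ m)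
    {d r : ℕ} (hunif : ∀ e ∈ E, e.card = r + 1)
    (hreg : ∀ e ∈ E, ∀ w ∈ e, (E.filter (w ∈ ·)).card = d) {k : ℕ} (hk : 2 * (k + 1) < g)
    (b : Bool) {w : α} (hw : (E.filter (w ∈ ·)).card = d) :
    ∫ x, treeIndicator E (k + 1) b ∅ w x ∂labelMeasure α = ∫ t in (0 : ℝ)..1, rootProb d r k b t := by
  rw [integral_eq_integral_update w (measurable_treeIndicator _ _ _ _) (treeIndicator_mem_Icc _ _ _ _),
    integral_uniformMeasure]
  refine intervalIntegral.integral_congr fun t ht => ?_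
  rw [Set.uIcc_of_le zero_le_one] at ht
  rw [integral_treeIndicator_update_succ hgirth hk hunif
    (integral_treeIndicator_update hgirth hunif hreg k (by omega)) b ∅ w ht,
    Finset.erase_eq_of_notMem (by simp), hw, rootProb]

/-- The indicator of a selected set satisfies the recursion. The edge `P` may be left out if it
contains a vertex that is inspected after `w`, because such an edge does not exclude `w`. -/
lemma ite_mem_eq_prod {G : Hypergraph α} {hG : G.vertexSet.Finite} {x : α → ℝ} {J : Finset α}
    (hJ : IsSelection G hG.toFinset x J) {w : α} (hw : w ∈ G.vertexSet) {P : Finset α}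
    (hP : w ∈ P → ∃ u ∈ P, u ≠ w ∧ x w ≤ x u) :
    (if w ∈ J then (1 : ℝ) else 0) = ∏ e ∈ ((edgeFinset G hG).filter (w ∈ ·)).erase P,
      (1 - ∏ w' ∈ e.erase w, if x w' < x w then (if w' ∈ J then (1 : ℝ) else 0) else 0) := by
  have hiff := hJ.2 w (hG.mem_toFinset.2 hw)
  split_ifs with hwJ
  · refine (Finset.prod_eq_one fun e he => ?_).symm
    obtain ⟨heE, hwe⟩ := Finset.mem_filter.1 (Finset.mem_of_mem_erase he)
    have hno := hiff.1 hwJ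
    obtain ⟨w', hw', hbad⟩ : ∃ w' ∈ e.erase w, ¬ (x w' < x w ∧ w' ∈ J) := by
      by_contra hcon
      push Not at hcon
      refine hno ⟨e, mem_edgeFinset.1 heE, hwe, fun y hy => ?_⟩
      by_cases hyw : y = w
      · exact Or.inl hyw
      · have := hcon y (Finset.mem_erase.2 ⟨hyw, hy⟩)
        exact Or.inr (Finset.mem_filter.2 ⟨this.2, this.1⟩)
    rw [Finset.prod_eq_zero hw', sub_zero]
    rw [← ite_and, if_neg hbad]
  · have hforms : G.FormsEdgeWith (J.filter fun y => x y < x w) w := by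
      by_contra h; exact hwJ (hiff.2 h)
    obtain ⟨e', he', hwe, hall⟩ := hforms
    obtain ⟨e, heE, rfl⟩ := exists_coe_eq_of_mem_edgeSet hG he'
    have hall' : ∀ y ∈ e.erase w, x y < x w ∧ y ∈ J := by
      intro y hy
      obtain ⟨hyw, hye⟩ := Finset.mem_erase.1 hy
      have := Finset.mem_filter.1 ((hall y hye).resolve_left hyw)
      exact ⟨this.2, this.1⟩
    have heP : e ≠ P := by
      rintro rfl
      obtain ⟨u, hu, huw, hle⟩ := hP hwe
      exact absurd (hall' u (Finset.mem_erase.2 ⟨huw, hu⟩)).1 (not_lt.2 hle)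
    refine (Finset.prod_eq_zero (i := e)
      (Finset.mem_erase.2 ⟨heP, Finset.mem_filter.2 ⟨heE, hwe⟩⟩) ?_).symm
    rw [Finset.prod_eq_one fun y hy => ?_, sub_self]
    rw [if_pos (hall' y hy).1, if_pos (hall' y hy).2]

lemma prod_one_sub_prod_le {ι κ : Type*} {s : Finset ι} {t : ι → Finset κ} {p q : ι → κ → ℝ}
    (hp : ∀ i ∈ s, ∀ j ∈ t i, 0 ≤ p i j) (hpq : ∀ i ∈ s, ∀ j ∈ t i, p i j ≤ q i j)
    (hq : ∀ i ∈ s, ∀ j ∈ t i, q i j ≤ 1) :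
    ∏ i ∈ s, (1 - ∏ j ∈ t i, q i j) ≤ ∏ i ∈ s, (1 - ∏ j ∈ t i, p i j) := by
  refine Finset.prod_le_prod (fun i hi => ?_) fun i hi => ?_
  · exact sub_nonneg.2 (Finset.prod_le_one (fun j hj => (hp i hi j hj).trans (hpq i hi j hj))
      (hq i hi))
  · exact sub_le_sub_left (Finset.prod_le_prod (hp i hi) (hpq i hi)) 1

/-- The truncated recursions bracket the indicator of the selected set. -/
lemma treeIndicator_le_ite_mem_le {G : Hypergraph α} {hG : G.vertexSet.Finite} {x : α → ℝ}
    {J : Finset α} (hJ : IsSelection G hG.toFinset x J) (k : ℕ) :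
    ∀ w ∈ G.vertexSet, ∀ P : Finset α, (w ∈ P → ∃ u ∈ P, u ≠ w ∧ x w ≤ x u) →
      treeIndicator (edgeFinset G hG) k false P w x ≤ (if w ∈ J then 1 else 0) ∧
      (if w ∈ J then 1 else 0) ≤ treeIndicator (edgeFinset G hG) k true P w x := by
  induction k with
  | zero =>
    intro w _ P _
    simp only [treeIndicator]
    split_ifs <;> simp_all
  | succ k ih =>
    intro w hw P hP
    have hchild : ∀ e ∈ ((edgeFinset G hG).filter (w ∈ ·)).erase P, ∀ w' ∈ e.erase w, x w' < x w →
        treeIndicator (edgeFinset G hG) k false e w' x ≤ (if w' ∈ J then 1 else 0) ∧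
        (if w' ∈ J then 1 else 0) ≤ treeIndicator (edgeFinset G hG) k true e w' x := by
      intro e he w' hw' hlt
      obtain ⟨heE, hwe⟩ := Finset.mem_filter.1 (Finset.mem_of_mem_erase he)
      obtain ⟨hne, hw'e⟩ := Finset.mem_erase.1 hw'
      exact ih w' (G.subset_vertexSet_of_mem_edgeSet (mem_edgeFinset.1 heE) hw'e) e
        fun _ => ⟨w, hwe, hne.symm, hlt.le⟩
    have hind : ∀ w', (if w' ∈ J then (1 : ℝ) else 0) ∈ Set.Icc (0 : ℝ) 1 := by
      intro w'; split_ifs <;> simp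
    rw [ite_mem_eq_prod hJ hw hP]
    constructor
    · refine prod_one_sub_prod_le (fun e he w' hw' => (ite_mem_Icc (hind w')).1)
        (fun e he w' hw' => ?_)
        fun e he w' hw' => (ite_mem_Icc (treeIndicator_mem_Icc k true e w' x)).2
      by_cases hlt : x w' < x w
      · rw [if_pos hlt, if_pos hlt]; exact (hchild e he w' hw' hlt).2
      · rw [if_neg hlt, if_neg hlt]
    · refine prod_one_sub_prod_le
        (fun e he w' hw' => (ite_mem_Icc (treeIndicator_mem_Icc k false e w' x)).1)
        (fun e he w' hw' => ?_) fun e he w' hw' => (ite_mem_Icc (hind w')).2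
      by_cases hlt : x w' < x w
      · rw [if_pos hlt, if_pos hlt]; exact (hchild e he w' hw' hlt).1
      · rw [if_neg hlt, if_neg hlt]

end Tree

/-! ### The expected size of the greedy set -/

open Classical in
lemma card_filter_edgeFinset {G : Hypergraph α} (hG : G.vertexSet.Finite) {d : ℕ}
    (hreg : G.IsRegular d) {w : α} (hw : w ∈ G.vertexSet) :
    ((edgeFinset G hG).filter (w ∈ ·)).card = d := by
  have himage : G.incidentEdges w =
      ((fun e : Finset α => (e : Set α)) '' ((edgeFinset G hG).filter (w ∈ ·) : Finset (Finset α))) := by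
    ext e
    constructor
    · rintro ⟨he, hwe⟩
      obtain ⟨f, hf, rfl⟩ := exists_coe_eq_of_mem_edgeSet hG he
      exact ⟨f, by simpa [hf] using hwe, rfl⟩
    · rintro ⟨f, hf, rfl⟩
      obtain ⟨hf, hwf⟩ := Finset.mem_filter.1 hf
      exact ⟨mem_edgeFinset.1 hf, hwf⟩
  rw [← (hreg w hw).2, himage, Set.ncard_image_of_injective _ Finset.coe_injective,
    Set.ncard_coe_finset]

/-- The expected size of the greedy set lies between the bounds from the two truncated
recursions. -/
lemma greedyExpectedSize_mem_Icc {G : Hypergraph α} (hG : G.vertexSet.Finite) {d r g k : ℕ}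
    (hr : 1 ≤ r) (hunif : G.IsUniform (r + 1)) (hreg : G.IsRegular d) (hg : G.HasGirth g)
    (hk : 2 * (k + 1) < g) :
    G.greedyExpectedSize hG ∈ Set.Icc
      ((∫ t in (0 : ℝ)..1, rootProb d r k false t) * (G.vertexSet.ncard : ℝ))
      ((∫ t in (0 : ℝ)..1, rootProb d r k true t) * (G.vertexSet.ncard : ℝ)) := by
  classical
  have hgirth : ∀ (m : ℕ) (x : α) (f l : Finset α),
      NonBacktracking (edgeFinset G hG) m x f l x → g ≤ m :=
    fun m x f l h => le_of_nonBacktracking_closed hg h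
  have hunif' : ∀ e ∈ edgeFinset G hG, e.card = r + 1 := fun e he => by
    rw [← Set.ncard_coe_finset, hunif _ (mem_edgeFinset.1 he)]
  have hreg' : ∀ e ∈ edgeFinset G hG, ∀ w ∈ e, ((edgeFinset G hG).filter (w ∈ ·)).card = d :=
    fun e he w hw => card_filter_edgeFinset hG hreg
      (G.subset_vertexSet_of_mem_edgeSet (mem_edgeFinset.1 he) hw)
  have hint : ∀ (b : Bool) (w : α), Integrable (treeIndicator (edgeFinset G hG) (k + 1) b ∅ w)
      (labelMeasure α) := fun b w =>
    integrable_of_mem_Icc (measurable_treeIndicator _ _ _ _) (treeIndicator_mem_Icc _ _ _ _)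
  have hroot : ∀ b : Bool, ∫ x, (∑ w ∈ hG.toFinset,
      treeIndicator (edgeFinset G hG) (k + 1) b ∅ w x) ∂labelMeasure α
        = (∫ t in (0 : ℝ)..1, rootProb d r k b t) * (G.vertexSet.ncard : ℝ) := by
    intro b
    rw [integral_finsetSum _ fun w _ => hint b w, Finset.sum_congr rfl fun w hw =>
      integral_treeIndicator_root hgirth hunif' hreg' hk b
        (card_filter_edgeFinset hG hreg (hG.mem_toFinset.1 hw)), Finset.sum_const, nsmul_eq_mul,
      mul_comm, Set.ncard_eq_toFinset_card _ hG]
  have hbracket : ∀ᵐ x ∂labelMeasure α,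
      ∑ w ∈ hG.toFinset, treeIndicator (edgeFinset G hG) (k + 1) false ∅ w x
        ≤ selectionSize G hG.toFinset x ∧
      selectionSize G hG.toFinset x
        ≤ ∑ w ∈ hG.toFinset, treeIndicator (edgeFinset G hG) (k + 1) true ∅ w x := by
    filter_upwards [ae_injOn hG.toFinset] with x hx
    obtain ⟨J, hJ⟩ := exists_isSelection G hG.toFinset x
    have hcard : (J.card : ℝ) = ∑ w ∈ hG.toFinset, if w ∈ J then (1 : ℝ) else 0 := by
      rw [← Finset.sum_filter, Finset.filter_mem_eq_inter, Finset.inter_eq_right.2 hJ.1]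
      simp
    rw [selectionSize_eq hJ hx, hcard]
    have h := fun w (hw : w ∈ hG.toFinset) => treeIndicator_le_ite_mem_le hJ (k + 1) w
      (hG.mem_toFinset.1 hw) ∅ (fun h => absurd h (Finset.notMem_empty w))
    exact ⟨Finset.sum_le_sum fun w hw => (h w hw).1, Finset.sum_le_sum fun w hw => (h w hw).2⟩
  rw [greedyExpectedSize_eq_integral hG hr hunif, ← hroot, ← hroot]
  exact ⟨integral_mono_ae (integrable_finsetSum _ fun w _ => hint _ w)
      (integrable_selectionSize _ _) (hbracket.mono fun x hx => hx.1),
    integral_mono_ae (integrable_selectionSize _ _) (integrable_finsetSum _ fun w _ => hint _ w)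
      (hbracket.mono fun x hx => hx.2)⟩

lemma greedyExpectedSize_le_indepNumber {G : Hypergraph α} (hG : G.vertexSet.Finite) {r : ℕ}
    (hr : 1 ≤ r) (hunif : G.IsUniform (r + 1)) : G.greedyExpectedSize hG ≤ (G.indepNumber : ℝ) := by
  have hne : ∀ e ∈ G.edgeSet, e.Nonempty := fun e he =>
    Set.nonempty_of_ncard_ne_zero (by rw [hunif e he]; omega)
  rw [greedyExpectedSize_eq_integral hG hr hunif]
  calc _ ≤ ∫ _, (G.indepNumber : ℝ) ∂labelMeasure α := by
        refine integral_mono_ae (integrable_selectionSize _ _) (integrable_const _) ?_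
        filter_upwards [ae_injOn hG.toFinset] with x hx
        obtain ⟨J, hJ⟩ := exists_isSelection G hG.toFinset x
        rw [selectionSize_eq hJ hx]
        rw [hG.coe_toFinset] at hx
        exact_mod_cast hJ.card_le_indepNumber hG hx hne
    _ = _ := by simp

end RandomGreedy

open RandomGreedy in
theorem theorem4 (r d : ℕ) (hr : 1 ≤ r) (hd : 2 ≤ d) :
    (∃! u : ℝ, IsGreedyRoot d r u) ∧
    Tendsto (fun g : ℕ => greedyError g d r) atTop (𝓝 0) ∧
    ∀ u : ℝ, IsGreedyRoot d r u →
      ∀ g : ℕ, 4 ≤ g →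
      ∀ {α : Type*} (G : Hypergraph α) (hG : G.vertexSet.Finite),
        G.IsUniform (r + 1) → G.IsRegular d → G.HasGirth g →
          (greedyDensity r u - greedyError g d r) * (G.vertexSet.ncard : ℝ)
              ≤ G.greedyExpectedSize hG ∧
          G.greedyExpectedSize hG
              ≤ (greedyDensity r u + greedyError g d r) * (G.vertexSet.ncard : ℝ) ∧
          (greedyDensity r u - greedyError g d r) * (G.vertexSet.ncard : ℝ)
              ≤ (G.indepNumber : ℝ) := by
  refine ⟨existsUnique_isGreedyRoot hr hd, tendsto_greedyError hr hd, ?_⟩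
  intro u hu g hg α G hG hunif hreg hgirth
  -- The truncated hypertree has `(g - 3) / 2 + 1 = (g - 1) / 2` levels of edges.
  obtain ⟨hu0, hu1, hu⟩ := (isGreedyRoot_iff hr hd).1 hu
  have hE := greedyExpectedSize_mem_Icc hG (k := (g - 3) / 2) hr hunif hreg hgirth (by omega)
  have hf := greedyDensity_mem_Icc hr hu0.le hu1 hu (by omega : 1 ≤ d) ((g - 3) / 2)
  have hgap := (abs_le.1 (integral_rootProb_sub_le (g := g) hr hd (by omega) true)).2
  rw [Bool.not_true] at hgap
  have hlow : (greedyDensity r u - greedyError g d r) * (G.vertexSet.ncard : ℝ)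
      ≤ G.greedyExpectedSize hG :=
    le_trans (mul_le_mul_of_nonneg_right (by linarith [hf.2]) (Nat.cast_nonneg _)) hE.1
  have hup : G.greedyExpectedSize hG
      ≤ (greedyDensity r u + greedyError g d r) * (G.vertexSet.ncard : ℝ) :=
    hE.2.trans (mul_le_mul_of_nonneg_right (by linarith [hf.1]) (Nat.cast_nonneg _))
  exact ⟨hlow, hup, hlow.trans (greedyExpectedSize_le_indepNumber hG hr hunif)⟩
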